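/- **Setting.** Let $\Omega\subset\mathbb R^d$ be bounded and let $V$ be a real Hilbert space of square-integrable functions on $\Omega$. Let $\mathcal A$ be a linear self-adjoint operator, used in weak form: $\int_\Omega\mathcal A(\phi)\psi$ is a symmetric bilinear form on $V$ (containing the natural boundary conditions). Let $\phi_1,\dots,\phi_n\in V$ be linearly independent finite-element basis functions that satisfy the essential boundary conditions, with mesh vertices $\mathbf p_1,\dots,\mathbf p_n$, mass matrix $\mathbf M=(\int_\Omega\phi_i\phi_j)_{ij}$ and stiffness matrix $\mathbf S=(\int_\Omega\phi_i\,\mathcal A(\phi_j))_{ij}$. Let $\Omega=\bigcup_{m=1}^N\Omega_m$, where the subdomains may overlap, and let $\partial\Omega_m=\bigcup_j\Gamma_{mj}$ with $\Gamma_{mm}=\partial\Omega\cap\partial\Omega_m$, $\Gamma_{mj}\subset\Omega_j$ for $j\ne m$, and $\Gamma_{mj}\cap\Gamma_{mh}=\emptyset$ for $j\neq h$. The internal indices of subdomain $m$ are $\mathfrak I_m=\{i:\mathbf p_i\in\mathrm{int}(\Omega_m)\cup\Gamma_{mm}\}$. For $\mathbf X\in\{\mathbf M,\mathbf S\}$ let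 $\mathbf X^{mm}$ be the submatrix of $\mathbf X$ on $\mathfrak I_m\times\mathfrak I_m$ and, for $j\ne m$, let $\mathbf X^{mj}$ be the $\mathfrak I_m\times\mathfrak I_j$ matrix whose entry $(i,k)$ is $X_{ik}$ if $\mathbf p_k\in\Gamma_{mj}$ and $0$ otherwise. Put $\tilde{\mathbf X}_D=\text{block-diag}(\mathbf X^{11},\dots,\mathbf X^{NN})$ and let $\tilde{\mathbf X}_F$ have blocks $\mathbf X^{mj}$ for $j\ne m$ and zero diagonal blocks. Let $\delta>0$, $L\ge1$ an integer, $\gamma\ge1$. Put $\mathbf E_m=(\mathbf M^{mm}+\delta\mathbf S^{mm})^{-1}$, $\mathbf A^m=\mathbf E_m\mathbf M^{mm}$, $\mathbf A^{mj}=\mathbf E_m(-\delta\mathbf S^{mj}-\mathbf M^{mj})$, $\bar{\mathbf A}^{mj}=\mathbf E_m\mathbf M^{mj}$, $\mathbf B^m=\delta\mathbf E_m$; and, globally, $\tilde{\mathbf E}=(\tilde{\mathbf M}_D+\delta\tilde{\mathbf S}_D)^{-1}$, $\tilde{\mathbf A}_D=\tilde{\mathbf E}\tilde{\mathbf M}_D=\text{block-diag}(\mathbf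 A^1,\dots,\mathbf A^N)$, $\tilde{\mathbf A}_F=\tilde{\mathbf E}(-\delta\tilde{\mathbf S}_F-\tilde{\mathbf M}_F)$, $\bar{\mathbf A}_F=\tilde{\mathbf E}\tilde{\mathbf M}_F$. Define $\tilde{\mathbf A}_{F,L}=\mathbf T_L-\tilde{\mathbf A}_D^L$, where $\mathbf T_{-1}=\mathbf T_0=\mathbf I$ and $\mathbf T_{\ell+1}=(\tilde{\mathbf A}_D+\tilde{\mathbf A}_F)\mathbf T_\ell+\bar{\mathbf A}_F\mathbf T_{\ell-1}$. **Filter.** Node $m$ has measurement function $\mathbf h^m$ and symmetric covariance parameters $\mathbf Q^m,\mathbf R^m$. With $\mathbf C_q^m$ the Jacobian of $\mathbf h^m$ at $\hat{\mathbf x}^m_{q|q-1}$ it computes, from its measurement $\mathbf y_q^m$, $$\mathbf L_q^m=\mathbf P^m_{q|q-1}(\mathbf C^m_q)^T\big(\mathbf R^m+\mathbf C^m_q\mathbf P^m_{q|q-1}(\mathbf C^m_q)^T\big)^{-1},$$ $$\hat{\mathbf x}^m_{q|q}=\hat{\mathbf x}^m_{q|q-1}+\mathbf L^m_q\big(\mathbf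 y^m_q-\mathbf h^m(\hat{\mathbf x}^m_{q|q-1})\big),\qquad \mathbf P^m_{q|q}=\mathbf P^m_{q|q-1}-\mathbf L^m_q\mathbf C^m_q\mathbf P^m_{q|q-1}.$$ Then, starting from $\hat{\mathbf x}^m_{q,0}=\hat{\mathbf x}^m_{q,-1}=\hat{\mathbf x}^m_{q|q}$ and $\mathbf P^m_{q,0}=\mathbf P^m_{q|q}$, it performs for $\ell=1,\dots,L$ the steps $$\hat{\mathbf x}^m_{q,\ell}=\mathbf A^m\hat{\mathbf x}^m_{q,\ell-1}+\sum_{j\ne m}\big(\mathbf A^{mj}\hat{\mathbf x}^j_{q,\ell-1}+\bar{\mathbf A}^{mj}\hat{\mathbf x}^j_{q,\ell-2}\big)+\mathbf B^m\mathbf u^m_{q,\ell},\qquad \mathbf P^m_{q,\ell}=\gamma^2\mathbf A^m\mathbf P^m_{q,\ell-1}(\mathbf A^m)^T+\mathbf Q^m,$$ and sets $\hat{\mathbf x}^m_{q+1|q}=\hat{\mathbf x}^m_{q,L}$, $\mathbf P^m_{q+1|q}=\mathbf P^m_{q,L}$. The initial covariances are symmetric positive semidefinite. The true states $\mathbf x^m$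 obey the same recursion in $\ell$ with additive model errors $\mathbf w^m_{q,\ell}$, and $\mathbf y^m_q=\mathbf h^m(\mathbf x^m_q)+\mathbf v^m_q$. **Assumptions.** A1: on the functions in $V$ satisfying the boundary conditions, the quadratic form $\int_\Omega\mathcal A(\psi)\psi$ is bounded and coercive. A2: $\mathbf h^m(\mathbf x)=\mathbf C^m\mathbf x$ for every $m$, and each pair $((\mathbf A^m)^L,\mathbf C^m)$ is observable. Moreover $\tilde{\mathbf Q}=\text{block-diag}(\mathbf Q^1,\dots,\mathbf Q^N)$ and $\tilde{\mathbf R}=\text{block-diag}(\mathbf R^1,\dots,\mathbf R^N)$ are positive definite. Put $\tilde{\mathbf C}=\text{block-diag}(\mathbf C^1,\dots,\mathbf C^N)$, $\tilde{\mathbf L}_q=\text{block-diag}(\mathbf L^1_q,\dots,\mathbf L^N_q)$ and $\tilde{\mathbf\Phi}=\sum_{i=0}^{L-1}\gamma^{2i}\tilde{\mathbf A}_D^i\tilde{\mathbf Q}(\tilde{\mathbf A}_D^i)^T$. **Theorem 2.** (i) The algebraic Riccati equation $$\tilde{\mathbf P}^{-1}=\Big[\gamma^{2L}\tilde{\mathbf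 A}_D^L\tilde{\mathbf P}(\tilde{\mathbf A}_D^L)^T+\tilde{\mathbf\Phi}\Big]^{-1}+\tilde{\mathbf C}^T\tilde{\mathbf R}^{-1}\tilde{\mathbf C}$$ has a unique symmetric positive definite solution $\tilde{\mathbf P}$, and the global covariance $\text{block-diag}(\mathbf P^1_{q|q},\dots,\mathbf P^N_{q|q})$ converges to $\tilde{\mathbf P}$ as $q\to\infty$. (ii) The global estimation error $\tilde{\mathbf e}_q=\mathrm{col}(\mathbf x^m_q-\hat{\mathbf x}^m_{q|q})_{m}$ obeys $$\tilde{\mathbf e}_{q+1}=(\mathbf I-\tilde{\mathbf L}_{q+1}\tilde{\mathbf C})(\tilde{\mathbf A}_D^L+\tilde{\mathbf A}_{F,L})\,\tilde{\mathbf e}_q+\tilde{\boldsymbol\nu}_q,\qquad \tilde{\boldsymbol\nu}_q=(\mathbf I-\tilde{\mathbf L}_{q+1}\tilde{\mathbf C})\tilde{\boldsymbol\omega}_q-\tilde{\mathbf L}_{q+1}\tilde{\mathbf v}_{q+1},$$ where $\tilde{\mathbf v}_{q+1}=\mathrm{col}(\mathbf v^m_{q+1})_m$ and $\tilde{\boldsymbol\omega}_q$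 is the value at $\ell=L$ of the recursion in $\ell$ started from $0$ and driven by the model errors $\mathbf w^m_{q,\ell}$ alone. If $$\gamma^L>\big\|\mathbf I+(\tilde{\mathbf A}_D^L)^{-1}\tilde{\mathbf A}_{F,L}\big\|_{\tilde{\mathbf P}},$$ where $\|\cdot\|_{\tilde{\mathbf P}}$ is the matrix norm induced by the vector norm $\|\mathbf x\|_{\tilde{\mathbf P}}=\sqrt{\mathbf x^T\tilde{\mathbf P}^{-1}\mathbf x}$, then these error dynamics are exponentially stable: there are $c>0$ and $\rho\in(0,1)$ such that every solution of the unforced dynamics ($\tilde{\boldsymbol\nu}\equiv0$), started at any time $q$, satisfies $\|\tilde{\mathbf e}_{q+k}\|\le c\,\rho^k\|\tilde{\mathbf e}_q\|$ for all $k\ge0$. -/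

import Mathlib

open MeasureTheory Filter Topology
open scoped Matrix

noncomputable section

/-! ### Generic notions for linear systems -/

/-- The pair `(A, C)` is observable: the observability matrix
`col (C, C A, …, C A ^ (n - 1))` has full column rank, i.e. trivial kernel. -/
def ObservablePair {ι κ : Type*} [Fintype ι] [DecidableEq ι]
    (A : Matrix ι ι ℝ) (C : Matrix κ ι ℝ) : Prop :=
  ∀ x : ι → ℝ, (∀ k < Fintype.card ι, (C * A ^ k) *ᵥ x = 0) → x = 0

/-- The vector norm `√(xᵀ W x)` (for `W` positive definite). -/
def weightedNorm {ι : Type*} [Fintype ι] (W : Matrix ι ι ℝ) (x : ι → ℝ) : ℝ :=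
  Real.sqrt (x ⬝ᵥ W *ᵥ x)

/-- The matrix norm induced by the vector norm `weightedNorm W`. -/
def inducedNorm {ι : Type*} [Fintype ι] (W X : Matrix ι ι ℝ) : ℝ :=
  sInf {c : ℝ | 0 ≤ c ∧ ∀ x : ι → ℝ, weightedNorm W (X *ᵥ x) ≤ c * weightedNorm W x}

/-- Exponential stability of the linear time-varying dynamics `e (q+1) = F q * e q (+ input)`:
every solution of the unforced dynamics, started at any time `q` from any value, decays
exponentially, with constants that depend neither on `q` nor on the solution.
(All norms on `ι → ℝ` are equivalent, so the choice of the norm is immaterial.) -/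
def ExponentiallyStable {ι : Type*} [Fintype ι] (F : ℕ → Matrix ι ι ℝ) : Prop :=
  ∃ c ρ : ℝ, 0 < c ∧ 0 < ρ ∧ ρ < 1 ∧
    ∀ (q : ℕ) (e : ℕ → ι → ℝ), (∀ k, e (k + 1) = F (q + k) *ᵥ e k) →
      ∀ k, ‖e k‖ ≤ c * ρ ^ k * ‖e 0‖

/-- The Kalman gain for prior covariance `P`, output matrix `C`, noise covariance `R`. -/
def kalmanGain {ι κ : Type*} [Fintype ι] [Fintype κ] [DecidableEq κ]
    (P : Matrix ι ι ℝ) (C : Matrix κ ι ℝ) (R : Matrix κ κ ℝ) : Matrix ι κ ℝ :=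
  P * Cᵀ * (R + C * P * Cᵀ)⁻¹

/-! ### The field model, its finite-element discretization, and the domain decomposition -/

/-- The PDE `∂x/∂t + 𝒜 x = f` on `Ω ⊆ ℝᵈ` with linear homogeneous boundary conditions, over a
Hilbert space `V` of square-integrable functions on `Ω`, a finite-element space spanned by `n`
basis functions, and a decomposition of `Ω` into `N` possibly overlapping subdomains. -/
structure FEModel (d n N : ℕ) (V W : Type*) [NormedAddCommGroup V] [InnerProductSpace ℝ V]
    [CompleteSpace V] [AddCommGroup W] [Module ℝ W] where
  /-- the space domain -/
  Ω : Set (EuclideanSpace ℝ (Fin d))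
  bounded_Ω : Bornology.IsBounded Ω
  measurable_Ω : MeasurableSet Ω
  /-- `V` consists of (classes of) square-integrable functions on `Ω` -/
  toL2 : V →ₗ[ℝ] Lp ℝ 2 (volume.restrict Ω)
  toL2_injective : Function.Injective toL2
  /-- the operator `𝒜` in weak form: `op φ ψ` is `∫_Ω 𝒜(φ) ψ` (for the heat equation and
  `V = H¹(Ω)`: `∫_Ω λ ∇φ · ∇ψ` plus the boundary term of the natural boundary conditions) -/
  op : V →ₗ[ℝ] Module.Dual ℝ V
  /-- `𝒜` is self-adjoint -/
  op_symm : ∀ φ ψ : V, op φ ψ = op ψ φ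
  /-- the essential part of the boundary operator (it is `0` if all the boundary conditions
  are natural, since these are contained in the weak form) -/
  bdry : V →ₗ[ℝ] W
  /-- the finite-element basis functions -/
  basis : Fin n → V
  basis_bdry : ∀ i, bdry (basis i) = 0
  basis_indep : LinearIndependent ℝ basis
  /-- the vertices of the mesh -/
  vertex : Fin n → EuclideanSpace ℝ (Fin d)
  /-- the subdomains `Ω_m` -/
  sub : Fin N → Set (EuclideanSpace ℝ (Fin d))
  iUnion_sub : Ω = ⋃ m, sub m
  /-- the pieces `Γ_{mj}` of the boundary of `Ω_m` -/
  Γ : Fin N → Fin N → Set (EuclideanSpace ℝ (Fin d))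
  Γ_self : ∀ m, Γ m m = frontier Ω ∩ frontier (sub m)
  frontier_sub : ∀ m, frontier (sub m) = ⋃ j, Γ m j
  Γ_subset : ∀ m j, j ≠ m → Γ m j ⊆ sub j
  Γ_disjoint : ∀ m j h, j ≠ h → Disjoint (Γ m j) (Γ m h)

namespace FEModel

variable {d n N : ℕ} {V W : Type*} [NormedAddCommGroup V] [InnerProductSpace ℝ V]
  [CompleteSpace V] [AddCommGroup W] [Module ℝ W] (D : FEModel d n N V W)

/-- Assumption A1: on the functions that satisfy the (essential) boundary conditions, the
quadratic form `∫_Ω 𝒜(ψ) ψ` is bounded and coercive. -/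
def A1 : Prop :=
  (∃ C : ℝ, ∀ ψ : V, D.bdry ψ = 0 → |D.op ψ ψ| ≤ C * ‖ψ‖ ^ 2) ∧
    (∃ c : ℝ, 0 < c ∧ ∀ ψ : V, D.bdry ψ = 0 → c * ‖ψ‖ ^ 2 ≤ D.op ψ ψ)

/-- The mass matrix `∫_Ω φ_i φ_j`. -/
def mass : Matrix (Fin n) (Fin n) ℝ :=
  Matrix.of fun i j => ∫ p in D.Ω, D.toL2 (D.basis i) p * D.toL2 (D.basis j) p

/-- The stiffness matrix `∫_Ω φ_i 𝒜(φ_j)`. -/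
def stiffness : Matrix (Fin n) (Fin n) ℝ :=
  Matrix.of fun i j => D.op (D.basis j) (D.basis i)

open scoped Classical in
/-- Indices of the internal vertices of subdomain `m`: those in `int Ω_m ∪ Γ_{mm}`. -/
def internal (m : Fin N) : Finset (Fin n) :=
  Finset.univ.filter fun i => D.vertex i ∈ interior (D.sub m) ∪ D.Γ m m

open scoped Classical in
/-- The in-neighbourhood of node `m`, without `m` itself. -/
def neighbors (m : Fin N) : Finset (Fin N) :=
  Finset.univ.filter fun j => j ≠ m ∧ (D.Γ m j).Nonempty

/-- The local (internal) states `x^m`, all nodes together. -/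
abbrev NodeStates : Type := ∀ m : Fin N, D.internal m → ℝ

/-- Index type of the global augmented state (with repetitions due to the overlaps). -/
abbrev GlobalIdx : Type := Σ m : Fin N, D.internal m

/-- The diagonal blocks `M^{mm}`, `S^{mm}` of a matrix over the global mesh. -/
def diagBlock (X : Matrix (Fin n) (Fin n) ℝ) (m : Fin N) :
    Matrix (D.internal m) (D.internal m) ℝ :=
  X.submatrix (fun i => (i : Fin n)) (fun i => (i : Fin n))

open scoped Classical in
/-- The interconnection blocks `M^{mj}`, `S^{mj}`, `j ≠ m`: node `m` couples to the state of node
`j` through the vertices on `Γ_{mj}`. -/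
def couplingBlock (X : Matrix (Fin n) (Fin n) ℝ) (m j : Fin N) :
    Matrix (D.internal m) (D.internal j) ℝ :=
  Matrix.of fun i k => if D.vertex (k : Fin n) ∈ D.Γ m j then X (i : Fin n) (k : Fin n) else 0

/-- `M̃_D`, `S̃_D`: the block-diagonal part of the augmented matrices. -/
def augD (X : Matrix (Fin n) (Fin n) ℝ) : Matrix D.GlobalIdx D.GlobalIdx ℝ :=
  Matrix.blockDiagonal' fun m => D.diagBlock X m

/-- `M̃_F`, `S̃_F`: the interconnection part of the augmented matrices. -/
def augF (X : Matrix (Fin n) (Fin n) ℝ) : Matrix D.GlobalIdx D.GlobalIdx ℝ :=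
  Matrix.of fun a b => if b.1 ≠ a.1 then D.couplingBlock X a.1 b.1 a.2 b.2 else 0

/-! #### Local matrices of the hybrid Euler scheme with time step `δ` -/

/-- `A^m`. -/
def Aloc (δ : ℝ) (m : Fin N) : Matrix (D.internal m) (D.internal m) ℝ :=
  (D.diagBlock D.mass m + δ • D.diagBlock D.stiffness m)⁻¹ * D.diagBlock D.mass m

/-- `A^{mj}`. -/
def Acpl (δ : ℝ) (m j : Fin N) : Matrix (D.internal m) (D.internal j) ℝ :=
  (D.diagBlock D.mass m + δ • D.diagBlock D.stiffness m)⁻¹ *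
    (-(δ • D.couplingBlock D.stiffness m j) - D.couplingBlock D.mass m j)

/-- `Ā^{mj}`. -/
def Abar (δ : ℝ) (m j : Fin N) : Matrix (D.internal m) (D.internal j) ℝ :=
  (D.diagBlock D.mass m + δ • D.diagBlock D.stiffness m)⁻¹ * D.couplingBlock D.mass m j

/-- `B^m`. -/
def Bloc (δ : ℝ) (m : Fin N) : Matrix (D.internal m) (D.internal m) ℝ :=
  δ • (D.diagBlock D.mass m + δ • D.diagBlock D.stiffness m)⁻¹

/-- The recursion
`x^m_ℓ = A^m x^m_{ℓ-1} + ∑_j A^{mj} x^j_{ℓ-1} + ∑_j Ā^{mj} x^j_{ℓ-2} + g^m_ℓ`, `ℓ = 1, 2, …`,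
initialized at `x_0 = x_{-1} = x₀`; the value at `ℓ` is the pair `(x_{ℓ-1}, x_ℓ)`. -/
def schwarz (δ : ℝ) (x₀ : D.NodeStates) (g : ℕ → D.NodeStates) :
    ℕ → D.NodeStates × D.NodeStates
  | 0 => (x₀, x₀)
  | l + 1 =>
    ((schwarz δ x₀ g l).2, fun m =>
      D.Aloc δ m *ᵥ (schwarz δ x₀ g l).2 m
        + ∑ j ∈ D.neighbors m, D.Acpl δ m j *ᵥ (schwarz δ x₀ g l).2 j
        + ∑ j ∈ D.neighbors m, D.Abar δ m j *ᵥ (schwarz δ x₀ g l).1 j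
        + g (l + 1) m)

/-! #### Global matrices of the hybrid Euler scheme -/

/-- `Ã_D`. -/
def AD (δ : ℝ) : Matrix D.GlobalIdx D.GlobalIdx ℝ :=
  (D.augD D.mass + δ • D.augD D.stiffness)⁻¹ * D.augD D.mass

/-- `Ã_F`. -/
def AF (δ : ℝ) : Matrix D.GlobalIdx D.GlobalIdx ℝ :=
  (D.augD D.mass + δ • D.augD D.stiffness)⁻¹ *
    (-(δ • D.augF D.stiffness) - D.augF D.mass)

/-- `Ā_F`. -/
def AFbar (δ : ℝ) : Matrix D.GlobalIdx D.GlobalIdx ℝ :=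
  (D.augD D.mass + δ • D.augD D.stiffness)⁻¹ * D.augF D.mass

/-- The pair `(T_{ℓ-1}, T_ℓ)` of transition matrices of the unforced global recursion
`x̃_{ℓ+1} = (Ã_D + Ã_F) x̃_ℓ + Ā_F x̃_{ℓ-1}`, `x̃_{-1} = x̃_0`, so that `x̃_ℓ = T_ℓ x̃_0`. -/
def transition (δ : ℝ) :
    ℕ → Matrix D.GlobalIdx D.GlobalIdx ℝ × Matrix D.GlobalIdx D.GlobalIdx ℝ
  | 0 => (1, 1)
  | l + 1 =>
    ((transition δ l).2,
      (D.AD δ + D.AF δ) * (transition δ l).2 + D.AFbar δ * (transition δ l).1)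

/-- `Ã_{F,L}`, defined by `x̃_L = Ã_D ^ L x̃_0 + Ã_{F,L} x̃_0` for the unforced recursion. -/
def AFL (δ : ℝ) (L : ℕ) : Matrix D.GlobalIdx D.GlobalIdx ℝ :=
  (D.transition δ L).2 - D.AD δ ^ L

/-- The global vector `col (x^1, …, x^N)`. -/
def col (x : D.NodeStates) : D.GlobalIdx → ℝ := fun a => x a.1 a.2

end FEModel

/-! ### The distributed finite-element Kalman filter -/

/-- The parameters of the distributed filter: node `m` has `r m` measurements. -/
structure FEFilter {d n N : ℕ} {V W : Type*} [NormedAddCommGroup V] [InnerProductSpace ℝ V]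
    [CompleteSpace V] [AddCommGroup W] [Module ℝ W] (D : FEModel d n N V W)
    (r : Fin N → ℕ) where
  /-- time step of one consensus iteration -/
  δ : ℝ
  δ_pos : 0 < δ
  /-- number of consensus iterations in each sampling interval -/
  L : ℕ
  L_pos : 0 < L
  /-- covariance boosting factor -/
  γ : ℝ
  one_le_γ : 1 ≤ γ
  /-- local measurement functions -/
  h : ∀ m, (D.internal m → ℝ) → (Fin (r m) → ℝ)
  /-- local process noise covariances -/
  Q : ∀ m, Matrix (D.internal m) (D.internal m) ℝ
  /-- local measurement noise covariances -/
  R : ∀ m, Matrix (Fin (r m)) (Fin (r m)) ℝ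

namespace FEFilter

variable {d n N : ℕ} {V W : Type*} [NormedAddCommGroup V] [InnerProductSpace ℝ V]
  [CompleteSpace V] [AddCommGroup W] [Module ℝ W] {D : FEModel d n N V W} {r : Fin N → ℕ}
  (E : FEFilter D r)

/-- Assumption A2: the local measurement functions are linear, `h^m (x) = C^m x`, and each pair
`((A^m)^L, C^m)` is observable. -/
def A2 (C : ∀ m, Matrix (Fin (r m)) (D.internal m) ℝ) : Prop :=
  (∀ m x, E.h m x = C m *ᵥ x) ∧ ∀ m, ObservablePair (D.Aloc E.δ m ^ E.L) (C m)

/-- Local estimates and local covariances of all the nodes. -/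
structure State (D : FEModel d n N V W) where
  est : D.NodeStates
  cov : ∀ m, Matrix (D.internal m) (D.internal m) ℝ

/-- The Jacobian of `h^m` at `x`. -/
def jac (m : Fin N) (x : D.internal m → ℝ) : Matrix (Fin (r m)) (D.internal m) ℝ :=
  LinearMap.toMatrix' (fderiv ℝ (E.h m) x : (D.internal m → ℝ) →ₗ[ℝ] (Fin (r m) → ℝ))

/-- The local gain at a prior state `s`. -/
def gain (s : State D) (m : Fin N) : Matrix (D.internal m) (Fin (r m)) ℝ :=
  kalmanGain (s.cov m) (E.jac m (s.est m)) (E.R m)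

/-- Correction step of the filter with the local measurements `y`. -/
def correct (s : State D) (y : ∀ m, Fin (r m) → ℝ) : State D where
  est := fun m => s.est m + E.gain s m *ᵥ (y m - E.h m (s.est m))
  cov := fun m => s.cov m - E.gain s m * E.jac m (s.est m) * s.cov m

/-- Covariance propagation `P_ℓ = γ² A^m P_{ℓ-1} (A^m)ᵀ + Q^m`, `P_0 = P`. -/
def covIter (m : Fin N) (P : Matrix (D.internal m) (D.internal m) ℝ) :
    ℕ → Matrix (D.internal m) (D.internal m) ℝ
  | 0 => P
  | l + 1 => E.γ ^ 2 • (D.Aloc E.δ m * covIter m P l * (D.Aloc E.δ m)ᵀ) + E.Q m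

/-- Consensus (prediction) step of the filter: `L` iterations with inputs `u ℓ`, `ℓ = 1, …, L`. -/
def predict (s : State D) (u : ℕ → D.NodeStates) : State D where
  est := (D.schwarz E.δ s.est (fun l m => D.Bloc E.δ m *ᵥ u l m) E.L).2
  cov := fun m => E.covIter m (s.cov m) E.L

/-- The prior estimates and covariances `x̂_{q|q-1}`, `P_{q|q-1}` produced by the filter from the
initial ones `s₀`, the measurements `y` and the inputs `u`. Sampling instants are numbered
from `0`. -/
def prior (s₀ : State D) (y : ℕ → ∀ m, Fin (r m) → ℝ) (u : ℕ → ℕ → D.NodeStates) :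
    ℕ → State D
  | 0 => s₀
  | q + 1 => E.predict (E.correct (prior s₀ y u q) (y q)) (u q)

/-- The posterior estimates and covariances `x̂_{q|q}`, `P_{q|q}`. -/
def posterior (s₀ : State D) (y : ℕ → ∀ m, Fin (r m) → ℝ) (u : ℕ → ℕ → D.NodeStates)
    (q : ℕ) : State D :=
  E.correct (E.prior s₀ y u q) (y q)

/-! #### Global quantities -/

/-- `Q̃`. -/
def Qglob : Matrix D.GlobalIdx D.GlobalIdx ℝ := Matrix.blockDiagonal' E.Q

/-- `R̃`. -/
def Rglob : Matrix (Σ m, Fin (r m)) (Σ m, Fin (r m)) ℝ := Matrix.blockDiagonal' E.R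

/-- The global covariance `block-diag (P^1_{q|q}, …, P^N_{q|q})`. -/
def globalCov (s₀ : State D) (y : ℕ → ∀ m, Fin (r m) → ℝ) (u : ℕ → ℕ → D.NodeStates)
    (q : ℕ) : Matrix D.GlobalIdx D.GlobalIdx ℝ :=
  Matrix.blockDiagonal' (E.posterior s₀ y u q).cov

/-- The global gain `L̃_q = block-diag (L^1_q, …, L^N_q)`. -/
def globalGain (s₀ : State D) (y : ℕ → ∀ m, Fin (r m) → ℝ) (u : ℕ → ℕ → D.NodeStates)
    (q : ℕ) : Matrix D.GlobalIdx (Σ m, Fin (r m)) ℝ :=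
  Matrix.blockDiagonal' (E.gain (E.prior s₀ y u q))

/-- `Φ̃ = ∑_{i < L} γ^{2i} Ã_D^i Q̃ (Ã_D^i)ᵀ`. -/
def Phi : Matrix D.GlobalIdx D.GlobalIdx ℝ :=
  ∑ i ∈ Finset.range E.L, E.γ ^ (2 * i) • (D.AD E.δ ^ i * E.Qglob * (D.AD E.δ ^ i)ᵀ)

/-- The algebraic Riccati equation
`P⁻¹ = [γ^{2L} Ã_D^L P (Ã_D^L)ᵀ + Φ̃]⁻¹ + C̃ᵀ R̃⁻¹ C̃`. -/
def Riccati (C : ∀ m, Matrix (Fin (r m)) (D.internal m) ℝ)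
    (P : Matrix D.GlobalIdx D.GlobalIdx ℝ) : Prop :=
  P⁻¹ = (E.γ ^ (2 * E.L) • (D.AD E.δ ^ E.L * P * (D.AD E.δ ^ E.L)ᵀ) + E.Phi)⁻¹
    + (Matrix.blockDiagonal' C)ᵀ * (E.Rglob)⁻¹ * Matrix.blockDiagonal' C

/-- The matrix `(I - L̃_{q+1} C̃) (Ã_D^L + Ã_{F,L})` of the estimation-error dynamics. -/
def errorMatrix (C : ∀ m, Matrix (Fin (r m)) (D.internal m) ℝ)
    (s₀ : State D) (y : ℕ → ∀ m, Fin (r m) → ℝ) (u : ℕ → ℕ → D.NodeStates)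
    (q : ℕ) : Matrix D.GlobalIdx D.GlobalIdx ℝ :=
  (1 - E.globalGain s₀ y u (q + 1) * Matrix.blockDiagonal' C) *
    (D.AD E.δ ^ E.L + D.AFL E.δ E.L)

/-- The true augmented state `x` at the sampling instants, with inputs `u`, model errors `w` and
measurements `y` corrupted by the noise `v`. -/
def IsPlant (x : ℕ → D.NodeStates) (u w : ℕ → ℕ → D.NodeStates)
    (y v : ℕ → ∀ m, Fin (r m) → ℝ) : Prop :=
  (∀ q, x (q + 1) =
    (D.schwarz E.δ (x q) (fun l m => D.Bloc E.δ m *ᵥ u q l m + w q l m) E.L).2) ∧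
  ∀ q m, y q m = E.h m (x q m) + v q m

/-- The global estimation error `x̃_q - x̂_{q|q}`. -/
def estError (x : ℕ → D.NodeStates) (s₀ : State D) (y : ℕ → ∀ m, Fin (r m) → ℝ)
    (u : ℕ → ℕ → D.NodeStates) (q : ℕ) : D.GlobalIdx → ℝ :=
  D.col (x q) - D.col (E.posterior s₀ y u q).est

/-- The driving term of the estimation-error dynamics: the model errors of the interval between
two samples, accumulated from zero and filtered, and the measurement noise times the gain. -/
def errorInput (C : ∀ m, Matrix (Fin (r m)) (D.internal m) ℝ)
    (s₀ : State D) (y : ℕ → ∀ m, Fin (r m) → ℝ) (u w : ℕ → ℕ → D.NodeStates)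
    (v : ℕ → ∀ m, Fin (r m) → ℝ) (q : ℕ) : D.GlobalIdx → ℝ :=
  (1 - E.globalGain s₀ y u (q + 1) * Matrix.blockDiagonal' C) *ᵥ
      D.col (D.schwarz E.δ (fun _ _ => 0) (w q) E.L).2
    - E.globalGain s₀ y u (q + 1) *ᵥ fun a => v (q + 1) a.1 a.2

end FEFilter

end

/-! Since every mass and stiffness block is block-diagonal and the measurements are linear, the
local covariances together form one Riccati recursion $P\mapsto((FPF^T+\Phi)^{-1}+H)^{-1}$ with
$F=\gamma^L\tilde A_D^L$ and $H=\tilde C^T\tilde R^{-1}\tilde C$. The mass and stiffness matrices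
are positive definite, so $F$ is invertible.

A fixed point is the limit of the iterates from $0$, which increase. They stay below $U=W^{-1}$,
where $W$ is a discounted observability Gramian of the backward system $F^{-1}$
(`exists_riccatiStep_le`); local observability makes $W$ positive definite. Uniqueness and
convergence come from a contraction: if $P\le tP'$ and $FP'F^T\le M\Phi$, one step replaces the
excess $t-1$ by $(t-1)M/(M+1)$ (`riccatiStep_contract`). Hence every orbit approaches a fixed point
up to factors tending to $1$.

For stability, $\tilde A_D^L+\tilde A_{F,L}=\gamma^{-L}F\,(I+(\tilde A_D^L)^{-1}\tilde A_{F,L})$. In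
the norms given by the inverses of the current covariances, neither $F$ (posterior to prior) nor
$I-\tilde L\tilde C$ (prior to posterior) expands (`quad_inv_predicted_le`,
`quad_inv_correction_le`). One step therefore costs at most the norm of the last factor divided by
$\gamma^L$, and replacing the current covariances by their limit costs factors tending to $1$. The
gain condition leaves room for these. -/

noncomputable section

/-! ### Quadratic forms of real matrices -/

section QuadraticForms

variable {ι κ : Type*} [Fintype ι] [Fintype κ]

/-- The quadratic form `xᵀ A x`. -/
def quad (A : Matrix ι ι ℝ) (x : ι → ℝ) : ℝ := x ⬝ᵥ A *ᵥ x

lemma quad_zero_left (x : ι → ℝ) : quad 0 x = 0 := by simp [quad]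

lemma quad_add (A B : Matrix ι ι ℝ) (x : ι → ℝ) : quad (A + B) x = quad A x + quad B x := by
  simp [quad, Matrix.add_mulVec]

lemma quad_smul (c : ℝ) (A : Matrix ι ι ℝ) (x : ι → ℝ) : quad (c • A) x = c * quad A x := by
  simp [quad, Matrix.smul_mulVec]

lemma quad_conj (B : Matrix κ ι ℝ) (A : Matrix ι ι ℝ) (x : κ → ℝ) :
    quad (B * A * Bᵀ) x = quad A (Bᵀ *ᵥ x) := by
  simp only [quad, ← Matrix.mulVec_mulVec]
  rw [Matrix.dotProduct_mulVec, ← Matrix.mulVec_transpose]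

lemma quad_conj' (B : Matrix ι κ ℝ) (A : Matrix ι ι ℝ) (x : κ → ℝ) :
    quad (Bᵀ * A * B) x = quad A (B *ᵥ x) := by
  simpa using quad_conj Bᵀ A x

lemma quad_smul_vec (A : Matrix ι ι ℝ) (c : ℝ) (x : ι → ℝ) :
    quad A (c • x) = c ^ 2 * quad A x := by
  simp only [quad, Matrix.mulVec_smul, dotProduct_smul, smul_dotProduct, smul_eq_mul]; ring

lemma dotProduct_mulVec_comm_of_symm {A : Matrix ι ι ℝ} (hA : Aᵀ = A) (x y : ι → ℝ) :
    x ⬝ᵥ A *ᵥ y = y ⬝ᵥ A *ᵥ x := by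
  rw [Matrix.dotProduct_mulVec, ← Matrix.mulVec_transpose, hA, dotProduct_comm]

lemma quad_add_vec {A : Matrix ι ι ℝ} (hA : Aᵀ = A) (x y : ι → ℝ) :
    quad A (x + y) = quad A x + 2 * (x ⬝ᵥ A *ᵥ y) + quad A y := by
  simp only [quad, Matrix.mulVec_add, dotProduct_add, add_dotProduct,
    dotProduct_mulVec_comm_of_symm hA y x]
  ring

lemma continuous_quad (A : Matrix ι ι ℝ) : Continuous (quad A) := by
  unfold quad
  exact continuous_id.dotProduct (continuous_const.matrix_mulVec continuous_id)

lemma posSemidef_iff_quad {A : Matrix ι ι ℝ} :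
    A.PosSemidef ↔ Aᵀ = A ∧ ∀ x, 0 ≤ quad A x := by
  rw [Matrix.posSemidef_iff_dotProduct_mulVec]
  simp [quad, Matrix.IsHermitian, Matrix.conjTranspose_eq_transpose_of_trivial]

lemma posDef_iff_quad {A : Matrix ι ι ℝ} :
    A.PosDef ↔ Aᵀ = A ∧ ∀ x, x ≠ 0 → 0 < quad A x := by
  rw [Matrix.posDef_iff_dotProduct_mulVec]
  simp [quad, Matrix.IsHermitian, Matrix.conjTranspose_eq_transpose_of_trivial]

lemma Matrix.PosSemidef.quad_nonneg {A : Matrix ι ι ℝ} (hA : A.PosSemidef) (x : ι → ℝ) :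
    0 ≤ quad A x := (posSemidef_iff_quad.1 hA).2 x

lemma Matrix.PosSemidef.transpose_eq {A : Matrix ι ι ℝ} (hA : A.PosSemidef) : Aᵀ = A :=
  (posSemidef_iff_quad.1 hA).1

lemma Matrix.PosSemidef.conj {A : Matrix ι ι ℝ} (hA : A.PosSemidef) (B : Matrix κ ι ℝ) :
    (B * A * Bᵀ).PosSemidef := by
  simpa [Matrix.conjTranspose_eq_transpose_of_trivial] using hA.mul_mul_conjTranspose_same B

lemma Matrix.PosSemidef.conj' {A : Matrix ι ι ℝ} (hA : A.PosSemidef) (B : Matrix ι κ ℝ) :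
    (Bᵀ * A * B).PosSemidef := by
  simpa using hA.conj Bᵀ

lemma Matrix.PosDef.mul_inv_eq_one [DecidableEq ι] {A : Matrix ι ι ℝ} (hA : A.PosDef) :
    A * A⁻¹ = 1 :=
  Matrix.mul_nonsing_inv A ((Matrix.isUnit_iff_isUnit_det A).1 hA.isUnit)

lemma Matrix.PosDef.inv_mul_eq_one [DecidableEq ι] {A : Matrix ι ι ℝ} (hA : A.PosDef) :
    A⁻¹ * A = 1 :=
  Matrix.nonsing_inv_mul A ((Matrix.isUnit_iff_isUnit_det A).1 hA.isUnit)

lemma Matrix.PosDef.inv_inv_eq [DecidableEq ι] {A : Matrix ι ι ℝ} (hA : A.PosDef) :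
    A⁻¹⁻¹ = A :=
  Matrix.nonsing_inv_nonsing_inv A ((Matrix.isUnit_iff_isUnit_det A).1 hA.isUnit)

lemma quad_mulVec_inv [DecidableEq ι] {A : Matrix ι ι ℝ} (hA : A.PosDef) (x : ι → ℝ) :
    quad A (A⁻¹ *ᵥ x) = quad A⁻¹ x := by
  simp only [quad, Matrix.mulVec_mulVec, hA.mul_inv_eq_one, Matrix.one_mulVec]
  rw [dotProduct_comm]

lemma quad_inv_mulVec [DecidableEq ι] {A : Matrix ι ι ℝ} (hA : A.PosDef) (x : ι → ℝ) :
    quad A⁻¹ (A *ᵥ x) = quad A x := by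
  have h := quad_mulVec_inv hA.inv x
  rwa [hA.inv_inv_eq] at h

/-- Inversion reverses the Loewner order. -/
lemma quad_inv_le [DecidableEq ι] {A B : Matrix ι ι ℝ} (hA : A.PosDef) (hB : B.PosDef) {c : ℝ}
    (hc : 0 < c) (h : ∀ x, quad A x ≤ c * quad B x) (x : ι → ℝ) :
    quad B⁻¹ x ≤ c * quad A⁻¹ x := by
  -- Expand the $A$-form at $cA^{-1}x-B^{-1}x$; the hypothesis at $B^{-1}x$ bounds its last term,
  -- which leaves $c\,(c\,x^TA^{-1}x-x^TB^{-1}x)\ge0$.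
  have h1 := hA.posSemidef.quad_nonneg (c • A⁻¹ *ᵥ x + (-1 : ℝ) • B⁻¹ *ᵥ x)
  rw [quad_add_vec hA.posSemidef.transpose_eq, quad_smul_vec, quad_smul_vec,
    quad_mulVec_inv hA, dotProduct_mulVec_comm_of_symm hA.posSemidef.transpose_eq] at h1
  have h2 := h (B⁻¹ *ᵥ x)
  rw [quad_mulVec_inv hB] at h2
  have h3 : ((-1 : ℝ) • B⁻¹ *ᵥ x) ⬝ᵥ A *ᵥ (c • A⁻¹ *ᵥ x) = - c * quad B⁻¹ x := by
    simp only [quad, Matrix.mulVec_smul, dotProduct_smul, smul_dotProduct, smul_eq_mul,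
      Matrix.mulVec_mulVec, hA.mul_inv_eq_one, Matrix.one_mulVec]
    rw [dotProduct_comm x]; ring
  rw [h3] at h1
  have h4 : 0 ≤ c * (c * quad A⁻¹ x - quad B⁻¹ x) := by nlinarith
  have := nonneg_of_mul_nonneg_right h4 hc
  linarith

/-- Every quadratic form is dominated by a multiple of a positive definite one. -/
lemma exists_quad_le {A : Matrix ι ι ℝ} (hA : A.PosDef) (B : Matrix ι ι ℝ) :
    ∃ c : ℝ, 1 ≤ c ∧ ∀ x, quad B x ≤ c * quad A x := by
  have hK : IsCompact (Metric.sphere (0 : ι → ℝ) 1) := isCompact_sphere 0 1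
  obtain ⟨c, hc⟩ : ∃ c : ℝ, ∀ x ∈ Metric.sphere (0 : ι → ℝ) 1, quad B x / quad A x ≤ c := by
    have hcont : ContinuousOn (fun x => quad B x / quad A x) (Metric.sphere (0 : ι → ℝ) 1) := by
      refine (continuous_quad B).continuousOn.div (continuous_quad A).continuousOn fun x hx => ?_
      have hx0 : x ≠ 0 := by
        rintro rfl
        simp at hx
      exact ((posDef_iff_quad.1 hA).2 x hx0).ne'
    obtain ⟨c, hc⟩ := (hK.image_of_continuousOn hcont).bddAbove
    exact ⟨c, fun x hx => hc ⟨x, hx, rfl⟩⟩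
  -- The contraction estimate needs a comparison factor that is at least $1$.
  refine ⟨max c 1, le_max_right _ _, fun x => ?_⟩
  rcases eq_or_ne x 0 with rfl | hx
  · simp [quad]
  have hn : 0 < ‖x‖ := norm_pos_iff.2 hx
  have hpos := (posDef_iff_quad.1 hA).2 x hx
  have h1 := hc (‖x‖⁻¹ • x) (by simp [norm_smul, hn.ne'])
  rw [quad_smul_vec, quad_smul_vec, mul_div_mul_left _ _ (by positivity)] at h1
  rw [div_le_iff₀ hpos] at h1
  exact h1.trans (mul_le_mul_of_nonneg_right (le_max_left _ _) hpos.le)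

/-- Entries of a symmetric matrix from its quadratic form. -/
lemma apply_eq_quad [DecidableEq ι] {A : Matrix ι ι ℝ} (hA : Aᵀ = A) (i j : ι) :
    A i j = (quad A (Pi.single i 1 + Pi.single j 1) - quad A (Pi.single i 1)
      - quad A (Pi.single j 1)) / 2 := by
  rw [quad_add_vec hA]
  have : (Pi.single i 1 : ι → ℝ) ⬝ᵥ A *ᵥ Pi.single j 1 = A i j := by simp
  rw [this]; ring

lemma eq_of_quad_eq {A B : Matrix ι ι ℝ} (hA : Aᵀ = A) (hB : Bᵀ = B)
    (h : ∀ x, quad A x = quad B x) : A = B := by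
  classical
  ext i j
  rw [apply_eq_quad hA, apply_eq_quad hB, h, h, h]

/-- Symmetric matrices converge as soon as their quadratic forms converge pointwise. -/
lemma tendsto_of_tendsto_quad {A : ℕ → Matrix ι ι ℝ} {B : Matrix ι ι ℝ}
    (hA : ∀ k, (A k)ᵀ = A k) (hB : Bᵀ = B)
    (h : ∀ x, Tendsto (fun k => quad (A k) x) atTop (𝓝 (quad B x))) :
    Tendsto A atTop (𝓝 B) := by
  classical
  refine tendsto_pi_nhds.2 fun i => tendsto_pi_nhds.2 fun j => ?_
  rw [apply_eq_quad hB]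
  simp only [apply_eq_quad (hA _)]
  exact (((h _).sub (h _)).sub (h _)).div_const 2

/-- A nondecreasing bounded sequence of symmetric matrices converges. -/
lemma exists_tendsto_of_monotone_quad {A : ℕ → Matrix ι ι ℝ} {U : Matrix ι ι ℝ}
    (hA : ∀ k, (A k)ᵀ = A k) (hmono : ∀ k x, quad (A k) x ≤ quad (A (k + 1)) x)
    (hU : ∀ k x, quad (A k) x ≤ quad U x) :
    ∃ B : Matrix ι ι ℝ, Tendsto A atTop (𝓝 B) := by
  classical
  have hconv : ∀ x, ∃ l, Tendsto (fun k => quad (A k) x) atTop (𝓝 l) := fun x =>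
    ⟨_, tendsto_atTop_ciSup (monotone_nat_of_le_succ fun k => hmono k x)
      ⟨quad U x, by rintro _ ⟨k, rfl⟩; exact hU k x⟩⟩
  choose l hl using hconv
  refine ⟨Matrix.of fun i j => (l (Pi.single i 1 + Pi.single j 1) - l (Pi.single i 1)
      - l (Pi.single j 1)) / 2, ?_⟩
  refine tendsto_pi_nhds.2 fun i => tendsto_pi_nhds.2 fun j => ?_
  simp only [apply_eq_quad (hA _), Matrix.of_apply]
  exact (((hl _).sub (hl _)).sub (hl _)).div_const 2

lemma tendsto_quad {A : ℕ → Matrix ι ι ℝ} {B : Matrix ι ι ℝ}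
    (h : Tendsto A atTop (𝓝 B)) (x : ι → ℝ) :
    Tendsto (fun k => quad (A k) x) atTop (𝓝 (quad B x)) := by
  have : Continuous fun M : Matrix ι ι ℝ => quad M x := by
    unfold quad
    exact continuous_const.dotProduct (continuous_id.matrix_mulVec continuous_const)
  exact (this.tendsto B).comp h

/-- Convergence in the part metric implies convergence. -/
lemma tendsto_of_eventually_le {p : ℕ → Matrix ι ι ℝ} (hp : ∀ k, (p k)ᵀ = p k)
    {P : Matrix ι ι ℝ} (hP : P.PosDef)
    (h : ∀ s : ℝ, 1 < s → ∀ᶠ k in atTop,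
      (∀ x, quad (p k) x ≤ s * quad P x) ∧ ∀ x, quad P x ≤ s * quad (p k) x) :
    Tendsto p atTop (𝓝 P) := by
  refine tendsto_of_tendsto_quad hp hP.posSemidef.transpose_eq fun x => ?_
  rcases eq_or_ne x 0 with rfl | hx
  · simp [quad]
  have hpos := (posDef_iff_quad.1 hP).2 x hx
  refine tendsto_order.2 ⟨fun a ha => ?_, fun a ha => ?_⟩
  · rcases le_or_gt a 0 with ha0 | ha0
    · filter_upwards [h 2 (by norm_num)] with k hk
      have := hk.2 x
      linarith
    -- The factor is the midpoint of $1$ and the ratio that would have to be exceeded, so the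
    -- comparison is strict.
    · have hs : 1 < (1 + quad P x / a) / 2 := by
        have : 1 < quad P x / a := by rwa [one_lt_div ha0]
        linarith
      filter_upwards [h _ hs] with k hk
      by_contra hcon
      have h1 := (hk.2 x).trans (mul_le_mul_of_nonneg_left (not_lt.1 hcon) (by linarith))
      have h2 : (1 + quad P x / a) / 2 * a = (a + quad P x) / 2 := by field_simp
      linarith
  · have hs : 1 < (1 + a / quad P x) / 2 := by
      have : 1 < a / quad P x := by rwa [one_lt_div hpos]
      linarith
    filter_upwards [h _ hs] with k hk
    have h1 := hk.1 x
    have h2 : (1 + a / quad P x) / 2 * quad P x = (a + quad P x) / 2 := by field_simp; ring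
    linarith

end QuadraticForms

/-! ### The Riccati map -/

section Riccati

variable {ι : Type*} [Fintype ι] {F Φ H G : Matrix ι ι ℝ} {a : ℝ}

lemma posDef_predicted (hΦ : Φ.PosDef) {P : Matrix ι ι ℝ} (hP : P.PosSemidef) :
    (F * P * Fᵀ + Φ).PosDef :=
  Matrix.PosDef.posSemidef_add (hP.conj F) hΦ

/-- Discounted observability Gramian `∑_{i < k} aⁱ (Gⁱ)ᵀ H Gⁱ`. -/
def discountedGramian (G H : Matrix ι ι ℝ) (a : ℝ) : ℕ → Matrix ι ι ℝ
  | 0 => 0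
  | k + 1 => a • (Gᵀ * discountedGramian G H a k * G) + H

lemma quad_discountedGramian_succ (k : ℕ) (x : ι → ℝ) :
    quad (discountedGramian G H a (k + 1)) x =
      a * quad (discountedGramian G H a k) (G *ᵥ x) + quad H x := by
  rw [discountedGramian, quad_add, quad_smul, quad_conj']

lemma posSemidef_discountedGramian (hH : H.PosSemidef) (ha : 0 ≤ a) (k : ℕ) :
    (discountedGramian G H a k).PosSemidef := by
  induction k with
  | zero => exact Matrix.PosSemidef.zero
  | succ k ih => exact ((ih.conj' G).smul ha).add hH

lemma discountedGramian_le_succ (hH : H.PosSemidef) (ha : 0 ≤ a) (k : ℕ) (x : ι → ℝ) :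
    quad (discountedGramian G H a k) x ≤ quad (discountedGramian G H a (k + 1)) x := by
  induction k generalizing x with
  | zero =>
    rw [discountedGramian, quad_zero_left]
    exact (posSemidef_discountedGramian hH ha 1).quad_nonneg x
  | succ k ih =>
    rw [quad_discountedGramian_succ, quad_discountedGramian_succ (k := k + 1)]
    have := mul_le_mul_of_nonneg_left (ih (G *ᵥ x)) ha
    linarith

/-- Gives a bound that does not involve $a$, so that a constant can be fixed first and the discount
chosen from it. -/
lemma discountedGramian_le_one (hH : H.PosSemidef) (ha : 0 ≤ a) (ha1 : a ≤ 1) (k : ℕ)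
    (x : ι → ℝ) :
    quad (discountedGramian G H a k) x ≤ quad (discountedGramian G H 1 k) x := by
  induction k generalizing x with
  | zero => rfl
  | succ k ih =>
    rw [quad_discountedGramian_succ, quad_discountedGramian_succ]
    have h1 := ih (G *ᵥ x)
    have h2 := (posSemidef_discountedGramian (G := G) hH ha k).quad_nonneg (G *ᵥ x)
    nlinarith

variable [DecidableEq ι]

/-- The Riccati map `P ↦ ((F P Fᵀ + Φ)⁻¹ + H)⁻¹`. -/
def riccatiStep (F Φ H P : Matrix ι ι ℝ) : Matrix ι ι ℝ := ((F * P * Fᵀ + Φ)⁻¹ + H)⁻¹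

lemma posDef_information (hΦ : Φ.PosDef) (hH : H.PosSemidef) {P : Matrix ι ι ℝ}
    (hP : P.PosSemidef) : ((F * P * Fᵀ + Φ)⁻¹ + H).PosDef :=
  (posDef_predicted hΦ hP).inv.add_posSemidef hH

lemma posDef_riccatiStep (hΦ : Φ.PosDef) (hH : H.PosSemidef) {P : Matrix ι ι ℝ}
    (hP : P.PosSemidef) : (riccatiStep F Φ H P).PosDef :=
  (posDef_information hΦ hH hP).inv

/-- Each of the two inversions reverses the order. Adding $H$ in between is harmless because $H\ge0$
and $s\ge1$. -/
lemma riccatiStep_le_smul (hΦ : Φ.PosDef) (hH : H.PosSemidef) {P P' : Matrix ι ι ℝ}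
    (hP : P.PosSemidef) (hP' : P'.PosSemidef) {s : ℝ} (hs : 1 ≤ s)
    (h : ∀ x, quad (F * P * Fᵀ + Φ) x ≤ s * quad (F * P' * Fᵀ + Φ) x) (x : ι → ℝ) :
    quad (riccatiStep F Φ H P) x ≤ s * quad (riccatiStep F Φ H P') x := by
  have hs0 : 0 < s := by linarith
  refine quad_inv_le (posDef_information hΦ hH hP') (posDef_information hΦ hH hP) hs0
    (fun z => ?_) x
  have h1 := quad_inv_le (posDef_predicted hΦ hP) (posDef_predicted hΦ hP') hs0 h z
  have h2 := hH.quad_nonneg z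
  rw [quad_add, quad_add]
  nlinarith

lemma riccatiStep_mono (hΦ : Φ.PosDef) (hH : H.PosSemidef) {P P' : Matrix ι ι ℝ}
    (hP : P.PosSemidef) (hP' : P'.PosSemidef) (h : ∀ x, quad P x ≤ quad P' x) (x : ι → ℝ) :
    quad (riccatiStep F Φ H P) x ≤ quad (riccatiStep F Φ H P') x := by
  have := riccatiStep_le_smul (F := F) hΦ hH hP hP' le_rfl (fun z => by
    rw [quad_add, quad_add, quad_conj, quad_conj]
    have := h (Fᵀ *ᵥ z)
    linarith) x
  linarith

/-- The Riccati map contracts the part metric. -/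
lemma riccatiStep_contract (hΦ : Φ.PosDef) (hH : H.PosSemidef) {P P' : Matrix ι ι ℝ}
    (hP : P.PosSemidef) (hP' : P'.PosSemidef) {t M : ℝ} (ht : 1 ≤ t) (hM : 0 ≤ M)
    (hb : ∀ x, quad (F * P' * Fᵀ) x ≤ M * quad Φ x)
    (h : ∀ x, quad P x ≤ t * quad P' x) (x : ι → ℝ) :
    quad (riccatiStep F Φ H P) x ≤
      (1 + (t - 1) * (M / (M + 1))) * quad (riccatiStep F Φ H P') x := by
  have hM1 : 0 < M + 1 := by linarith
  have hθ : 0 ≤ (t - 1) * (M / (M + 1)) := mul_nonneg (by linarith) (by positivity)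
  refine riccatiStep_le_smul hΦ hH hP hP' (by linarith) (fun z => ?_) x
  have h1 := h (Fᵀ *ᵥ z)
  have h2 := hb z
  have h3 : (t - 1) * (M / (M + 1)) * (M + 1) = (t - 1) * M := by field_simp
  rw [quad_add, quad_add, quad_conj, quad_conj]
  rw [quad_conj] at h2
  set X := quad P' (Fᵀ *ᵥ z)
  set Y := quad P (Fᵀ *ᵥ z)
  set φ := quad Φ z
  set k := (t - 1) * (M / (M + 1)) with hk
  -- It suffices that $tX+\varphi\le(1+k)(X+\varphi)$, that is, $(t-1-k)X\le k\varphi$. The value of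
  -- $k$ makes $t-1-k=(t-1)/(M+1)$, and $X\le M\varphi$ closes the gap.
  have h4 : t - 1 = k + (t - 1) / (M + 1) := by rw [hk]; field_simp
  have h5 : k = (t - 1) / (M + 1) * M := by rw [hk]; ring
  have h6 : 0 ≤ (t - 1) / (M + 1) := div_nonneg (by linarith) hM1.le
  have h7 : (t - 1) / (M + 1) * X ≤ (t - 1) / (M + 1) * (M * φ) :=
    mul_le_mul_of_nonneg_left h2 h6
  have h8 : t * X = X + k * X + (t - 1) / (M + 1) * X := by
    have : t = 1 + (k + (t - 1) / (M + 1)) := by linarith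
    calc t * X = (1 + (k + (t - 1) / (M + 1))) * X := by rw [← this]
      _ = _ := by ring
  have h9 : (t - 1) / (M + 1) * (M * φ) = k * φ := by rw [h5]; ring
  nlinarith

/-- `p` is an orbit of the Riccati map. -/
def IsRiccatiOrbit (F Φ H : Matrix ι ι ℝ) (p : ℕ → Matrix ι ι ℝ) : Prop :=
  (∀ k, (p k).PosDef) ∧ ∀ k, p (k + 1) = riccatiStep F Φ H (p k)

/-- Iterates the contraction. Only the dominating orbit `p'` needs a bound relative to $\Phi$, but
the same $M$ must serve at all times. -/
lemma IsRiccatiOrbit.le_geometric (hΦ : Φ.PosDef) (hH : H.PosSemidef) {p p' : ℕ → Matrix ι ι ℝ}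
    (hp : IsRiccatiOrbit F Φ H p) (hp' : IsRiccatiOrbit F Φ H p') {t M : ℝ} (ht : 1 ≤ t)
    (hM : 0 ≤ M) (hb : ∀ k x, quad (F * p' k * Fᵀ) x ≤ M * quad Φ x)
    (h : ∀ x, quad (p 0) x ≤ t * quad (p' 0) x) (k : ℕ) (x : ι → ℝ) :
    quad (p k) x ≤ (1 + (t - 1) * (M / (M + 1)) ^ k) * quad (p' k) x := by
  induction k generalizing x with
  | zero => simpa using h x
  | succ k ih =>
    have hθ : 0 ≤ (t - 1) * (M / (M + 1)) ^ k := mul_nonneg (by linarith) (by positivity)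
    have := riccatiStep_contract hΦ hH (hp.1 k).posSemidef (hp'.1 k).posSemidef
      (t := 1 + (t - 1) * (M / (M + 1)) ^ k) (by linarith) hM (hb k) ih x
    rw [hp.2, hp'.2]
    convert this using 2
    ring

lemma isRiccatiOrbit_const {P : Matrix ι ι ℝ} (hP : P.PosDef) (h : riccatiStep F Φ H P = P) :
    IsRiccatiOrbit F Φ H fun _ => P :=
  ⟨fun _ => hP, fun _ => h.symm⟩

lemma eventually_one_add_mul_pow_le {t M s : ℝ} (hM : 0 ≤ M) (hs : 1 < s) :
    ∀ᶠ k : ℕ in atTop, 1 + (t - 1) * (M / (M + 1)) ^ k ≤ s := by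
  have h0 : Tendsto (fun k : ℕ => (M / (M + 1)) ^ k) atTop (𝓝 0) :=
    tendsto_pow_atTop_nhds_zero_of_lt_one (by positivity) (by rw [div_lt_one] <;> linarith)
  have h1 : Tendsto (fun k : ℕ => 1 + (t - 1) * (M / (M + 1)) ^ k) atTop (𝓝 1) := by
    simpa using (h0.const_mul (t - 1)).const_add 1
  exact h1.eventually_le_const hs

/-- Every orbit converges to a fixed point in the part metric. -/
lemma IsRiccatiOrbit.eventually_le (hΦ : Φ.PosDef) (hH : H.PosSemidef)
    {p : ℕ → Matrix ι ι ℝ} (hp : IsRiccatiOrbit F Φ H p) {P : Matrix ι ι ℝ} (hP : P.PosDef)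
    (hfix : riccatiStep F Φ H P = P) {s : ℝ} (hs : 1 < s) :
    ∀ᶠ k in atTop, (∀ x, quad (p k) x ≤ s * quad P x) ∧ ∀ x, quad P x ≤ s * quad (p k) x := by
  have hc := isRiccatiOrbit_const hP hfix
  obtain ⟨t, ht, h1⟩ := exists_quad_le hP (p 0)
  obtain ⟨t', ht', h1'⟩ := exists_quad_le (hp.1 0) P
  obtain ⟨M, hM, h2⟩ := exists_quad_le hΦ (F * P * Fᵀ)
  have hM0 : 0 ≤ M := by linarith
  -- Here the dominating orbit is the constant $P$, so $M$ is available at once.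
  have hup := hp.le_geometric hΦ hH hc ht hM0 (fun _ => h2) h1
  have hbound : ∀ k x, quad (p k) x ≤ t * quad P x := fun k x => by
    refine (hup k x).trans (mul_le_mul_of_nonneg_right ?_ (hP.posSemidef.quad_nonneg x))
    have : (M / (M + 1)) ^ k ≤ 1 := pow_le_one₀ (by positivity) (by rw [div_le_one] <;> linarith)
    nlinarith
  -- Now the roles are exchanged and the dominating orbit moves; the upper bound $p_k\le tP$ just
  -- obtained supplies the uniform constant $tM$.
  have hlow := hc.le_geometric hΦ hH hp ht' (M := t * M) (by positivity) (fun k x => by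
    have h3 := hbound k (Fᵀ *ᵥ x)
    have h4 := h2 x
    rw [quad_conj] at h4 ⊢
    nlinarith) h1'
  filter_upwards [eventually_one_add_mul_pow_le (t := t) hM0 hs,
    eventually_one_add_mul_pow_le (t := t') (M := t * M) (by positivity) hs] with k hk hk'
  exact ⟨fun x => (hup k x).trans (mul_le_mul_of_nonneg_right hk (hP.posSemidef.quad_nonneg x)),
    fun x => (hlow k x).trans
      (mul_le_mul_of_nonneg_right hk' ((hp.1 k).posSemidef.quad_nonneg x))⟩

/-- A second fixed point is a constant orbit, hence within every factor $s>1$ of the first; let $s$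
decrease to $1$. -/
lemma riccatiStep_fixedPoint_unique (hΦ : Φ.PosDef) (hH : H.PosSemidef) {P P' : Matrix ι ι ℝ}
    (hP : P.PosDef) (hP' : P'.PosDef) (hfix : riccatiStep F Φ H P = P)
    (hfix' : riccatiStep F Φ H P' = P') : P' = P := by
  have key : ∀ s : ℝ, 1 < s →
      (∀ x, quad P' x ≤ s * quad P x) ∧ ∀ x, quad P x ≤ s * quad P' x := fun s hs =>
    (((isRiccatiOrbit_const hP' hfix').eventually_le hΦ hH hP hfix hs).exists).choose_spec
  have lim : ∀ a b : ℝ, (∀ s : ℝ, 1 < s → a ≤ s * b) → a ≤ b := fun a b h => by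
    have hcont : Tendsto (fun s : ℝ => s * b) (𝓝[>] 1) (𝓝 (1 * b)) :=
      ((continuous_id.mul continuous_const).tendsto _).mono_left nhdsWithin_le_nhds
    rw [one_mul] at hcont
    exact ge_of_tendsto hcont (eventually_mem_nhdsWithin.mono fun s hs => h s hs)
  exact eq_of_quad_eq hP'.posSemidef.transpose_eq hP.posSemidef.transpose_eq fun x =>
    le_antisymm (lim _ _ fun s hs => (key s hs).1 x) (lim _ _ fun s hs => (key s hs).2 x)

/-! #### Existence of a fixed point -/

/-- The Gramian is a sum of nonnegative terms with positive weights, so if it vanishes at $x$, each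
term does. -/
lemma quad_pow_mulVec_eq_zero (hH : H.PosSemidef) (ha : 0 < a) {k : ℕ} {x : ι → ℝ}
    (hx : quad (discountedGramian G H a k) x = 0) : ∀ i < k, quad H ((G ^ i) *ᵥ x) = 0 := by
  induction k generalizing x with
  | zero => simp
  | succ k ih =>
    rw [quad_discountedGramian_succ] at hx
    have h1 := (posSemidef_discountedGramian (G := G) hH ha.le k).quad_nonneg (G *ᵥ x)
    have h2 := hH.quad_nonneg x
    have h3 : quad H x = 0 := by nlinarith
    have h4 : quad (discountedGramian G H a k) (G *ᵥ x) = 0 := by nlinarith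
    intro i hi
    cases i with
    | zero => simpa using h3
    | succ i => simpa [pow_succ, Matrix.mulVec_mulVec] using ih h4 i (by omega)

lemma posDef_discountedGramian (hH : H.PosSemidef) (ha : 0 < a) {k : ℕ}
    (hobs : ∀ x, (∀ i < k, quad H ((G ^ i) *ᵥ x) = 0) → x = 0) :
    (discountedGramian G H a k).PosDef := by
  have h := posSemidef_discountedGramian (G := G) hH ha.le k
  exact posDef_iff_quad.2 ⟨h.transpose_eq, fun x hx => (h.quad_nonneg x).lt_of_ne' fun h0 =>
    hx (hobs x (quad_pow_mulVec_eq_zero hH ha h0))⟩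

/-- Observability of the backward system yields a matrix that the Riccati map does not enlarge. -/
lemma exists_riccatiStep_le (hF : IsUnit F) (hΦ : Φ.PosDef) (hH : H.PosSemidef) {k : ℕ}
    (hobs : ∀ x, (∀ i < k, quad H ((F⁻¹ ^ i) *ᵥ x) = 0) → x = 0) :
    ∃ U : Matrix ι ι ℝ, U.PosDef ∧ (∀ x, quad (riccatiStep F Φ H U) x ≤ quad U x) ∧
      ∀ x, quad (riccatiStep F Φ H 0) x ≤ quad U x := by
  set G := F⁻¹ with hG
  have hdet := (Matrix.isUnit_iff_isUnit_det F).1 hF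
  have hFG : F * G = 1 := Matrix.mul_nonsing_inv F hdet
  have hGF : G * F = 1 := Matrix.nonsing_inv_mul F hdet
  -- The constant $c$ comes from the undiscounted Gramian, so the discount $a=1/(1+c)$ can depend on
  -- it. The candidate is $U=W^{-1}$.
  obtain ⟨c, hc, hcle⟩ := exists_quad_le hΦ.inv (Gᵀ * discountedGramian G H 1 k * G)
  set a : ℝ := (1 + c)⁻¹ with ha_def
  have ha : 0 < a := by positivity
  have hac : a * (1 + c) = 1 := inv_mul_cancel₀ (by linarith)
  have ha1 : a ≤ 1 := by nlinarith
  set Wm := discountedGramian G H a k with hWm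
  have hW : Wm.PosDef := posDef_discountedGramian hH ha hobs
  have hUinv : Wm⁻¹⁻¹ = Wm := hW.inv_inv_eq
  have hGWG : ∀ x, quad Wm (G *ᵥ x) ≤ c * quad Φ⁻¹ x := fun x => by
    have := hcle x
    rw [quad_conj'] at this
    exact (discountedGramian_le_one hH ha.le ha1 k _).trans this
  have hpredinv : (F * Wm⁻¹ * Fᵀ)⁻¹ = Gᵀ * Wm * G := by
    refine Matrix.inv_eq_right_inv ?_
    calc F * Wm⁻¹ * Fᵀ * (Gᵀ * Wm * G) = F * Wm⁻¹ * (Fᵀ * Gᵀ) * Wm * G := by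
          simp only [Matrix.mul_assoc]
      _ = F * (Wm⁻¹ * Wm) * G := by
          rw [← Matrix.transpose_mul, hGF, Matrix.transpose_one]; simp only [Matrix.mul_assoc,
            Matrix.one_mul]
      _ = 1 := by rw [hW.inv_mul_eq_one, Matrix.mul_one, hFG]
  have hpred : (F * Wm⁻¹ * Fᵀ).PosDef := by
    refine posDef_iff_quad.2 ⟨(hW.inv.posSemidef.conj F).transpose_eq, fun x hx => ?_⟩
    rw [quad_conj]
    refine (posDef_iff_quad.1 hW.inv).2 _ fun h0 => hx ?_
    have : Gᵀ *ᵥ (Fᵀ *ᵥ x) = x := by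
      rw [Matrix.mulVec_mulVec, ← Matrix.transpose_mul, hFG]; simp
    rw [← this, h0, Matrix.mulVec_zero]
  have hΦle : ∀ x, quad Φ x ≤ c * quad (F * Wm⁻¹ * Fᵀ) x := fun x => by
    have := quad_inv_le (A := (F * Wm⁻¹ * Fᵀ)⁻¹) (B := Φ⁻¹) hpred.inv hΦ.inv (c := c)
      (by linarith) (fun z => by rw [hpredinv, quad_conj']; exact hGWG z) x
    rwa [hΦ.inv_inv_eq, hpred.inv_inv_eq] at this
  refine ⟨Wm⁻¹, hW.inv, fun x => ?_, fun x => ?_⟩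
  -- Since $\Phi\le c\,FUF^T$, the predicted covariance is at most $(1+c)FUF^T$ and its inverse at
  -- least $a\,G^TWG$. Adding $H$ gives the Gramian with one more term, which dominates $W$;
  -- inverting gives the claim.
  · have h1 := quad_inv_le hW (posDef_information (F := F) hΦ hH hW.inv.posSemidef) one_pos
      (fun z => ?_) x
    · simpa [riccatiStep] using h1
    have h2 := quad_inv_le (posDef_predicted (F := F) hΦ hW.inv.posSemidef) hpred (c := 1 + c)
      (by linarith) (fun y => by
        rw [quad_add]
        have := hΦle y
        linarith) z
    rw [hpredinv, quad_conj'] at h2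
    have h3 := discountedGramian_le_succ (G := G) hH ha.le k z
    rw [quad_discountedGramian_succ, ← hWm] at h3
    rw [quad_add, one_mul]
    have h4 := mul_le_mul_of_nonneg_left h2 ha.le
    rw [← mul_assoc, hac, one_mul] at h4
    linarith
  -- From $0$ the information is $\Phi^{-1}+H$, and $a\,G^TWG\le ac\,\Phi^{-1}\le\Phi^{-1}$.
  · have h1 := quad_inv_le hW (posDef_information (F := F) hΦ hH Matrix.PosSemidef.zero) one_pos
      (fun z => ?_) x
    · simpa [riccatiStep] using h1
    have h3 := discountedGramian_le_succ (G := G) hH ha.le k z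
    rw [quad_discountedGramian_succ, ← hWm] at h3
    have h4 := mul_le_mul_of_nonneg_left (hGWG z) ha.le
    have h5 := hΦ.inv.posSemidef.quad_nonneg z
    have h6 : a * c ≤ 1 := by nlinarith
    simp only [quad_add, Matrix.mul_zero, Matrix.zero_mul, zero_add, one_mul]
    nlinarith

lemma tendsto_riccatiStep (hΦ : Φ.PosDef) (hH : H.PosSemidef) {p : ℕ → Matrix ι ι ℝ}
    {P : Matrix ι ι ℝ} (hP : P.PosDef) (h : Tendsto p atTop (𝓝 P)) :
    Tendsto (fun k => riccatiStep F Φ H (p k)) atTop (𝓝 (riccatiStep F Φ H P)) := by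
  have hinv : ∀ A : Matrix ι ι ℝ, A.PosDef → ContinuousAt Inv.inv A := fun A hA => by
    refine continuousAt_matrix_inv A ?_
    have hdet := (Matrix.isUnit_iff_isUnit_det A).1 hA.isUnit
    rw [Ring.inverse_eq_inv']
    exact continuousAt_inv₀ hdet.ne_zero
  have h1 : Tendsto (fun k => F * p k * Fᵀ + Φ) atTop (𝓝 (F * P * Fᵀ + Φ)) :=
    ((h.const_mul F).mul_const Fᵀ).add_const Φ
  have h2 := ((hinv _ (posDef_predicted (F := F) hΦ hP.posSemidef)).tendsto.comp h1).add_const H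
  exact (hinv _ (posDef_information (F := F) hΦ hH hP.posSemidef)).tendsto.comp h2

theorem exists_riccatiStep_eq_self (hF : IsUnit F) (hΦ : Φ.PosDef) (hH : H.PosSemidef) {k : ℕ}
    (hobs : ∀ x, (∀ i < k, quad H ((F⁻¹ ^ i) *ᵥ x) = 0) → x = 0) :
    ∃ P : Matrix ι ι ℝ, P.PosDef ∧ riccatiStep F Φ H P = P := by
  obtain ⟨U, hU, hUstep, hU0⟩ := exists_riccatiStep_le hF hΦ hH hobs
  -- The shift by one makes every term positive definite; the limit dominates the first term and so
  -- is positive definite too.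
  let p : ℕ → Matrix ι ι ℝ := fun j => (riccatiStep F Φ H)^[j + 1] 0
  have hsucc : ∀ j, p (j + 1) = riccatiStep F Φ H (p j) := fun j =>
    Function.iterate_succ_apply' _ _ _
  have hpd : ∀ j, (p j).PosDef := fun j => by
    induction j with
    | zero => exact posDef_riccatiStep hΦ hH Matrix.PosSemidef.zero
    | succ j ih => rw [hsucc]; exact posDef_riccatiStep hΦ hH ih.posSemidef
  have hmono : ∀ j x, quad (p j) x ≤ quad (p (j + 1)) x := fun j => by
    induction j with
    | zero =>
      rw [hsucc]
      exact riccatiStep_mono hΦ hH Matrix.PosSemidef.zero (hpd 0).posSemidef fun x => by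
        rw [quad_zero_left]; exact (hpd 0).posSemidef.quad_nonneg x
    | succ j ih =>
      rw [hsucc (j + 1)]
      nth_rewrite 1 [hsucc j]
      exact riccatiStep_mono hΦ hH (hpd _).posSemidef (hpd _).posSemidef ih
  have hle : ∀ j x, quad (p j) x ≤ quad U x := fun j => by
    induction j with
    | zero => exact hU0
    | succ j ih =>
      rw [hsucc]
      exact fun x => (riccatiStep_mono hΦ hH (hpd _).posSemidef hU.posSemidef ih x).trans
        (hUstep x)
  obtain ⟨P, hlim⟩ := exists_tendsto_of_monotone_quad
    (fun j => (hpd j).posSemidef.transpose_eq) hmono hle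
  have hsymm : Pᵀ = P := by
    have h1 : Tendsto (fun j => (p j)ᵀ) atTop (𝓝 Pᵀ) :=
      (continuous_id.matrix_transpose.tendsto P).comp hlim
    simp only [(hpd _).posSemidef.transpose_eq] at h1
    exact tendsto_nhds_unique h1 hlim
  have hP : P.PosDef := posDef_iff_quad.2 ⟨hsymm, fun x hx =>
    ((posDef_iff_quad.1 (hpd 0)).2 x hx).trans_le
      (ge_of_tendsto (tendsto_quad hlim x) (Eventually.of_forall fun j =>
        (monotone_nat_of_le_succ fun i => hmono i x) (Nat.zero_le j)))⟩
  refine ⟨P, hP, ?_⟩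
  have h1 := tendsto_riccatiStep (F := F) hΦ hH hP hlim
  simp only [← hsucc] at h1
  exact tendsto_nhds_unique h1 ((tendsto_add_atTop_iff_nat 1).2 hlim)

lemma pow_mul_inv_pow_add (hF : IsUnit F) (j i : ℕ) : F ^ j * F⁻¹ ^ (j + i) = F⁻¹ ^ i := by
  have h := Matrix.mul_nonsing_inv F ((Matrix.isUnit_iff_isUnit_det F).1 hF)
  induction j with
  | zero => simp
  | succ j ih =>
    rw [pow_succ, show j + 1 + i = (j + i) + 1 by ring, pow_succ' F⁻¹, Matrix.mul_assoc,
      ← Matrix.mul_assoc F, h, Matrix.one_mul, ih]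

end Riccati

/-! ### The Kalman correction step -/

section Kalman

variable {ι κ : Type*} [Fintype ι] [Fintype κ] [DecidableEq ι] [DecidableEq κ]
  {P : Matrix ι ι ℝ} {C : Matrix κ ι ℝ} {R : Matrix κ κ ℝ}

omit [DecidableEq ι] in
lemma posSemidef_information (hR : R.PosDef) : (Cᵀ * R⁻¹ * C).PosSemidef :=
  hR.inv.posSemidef.conj' C

/-- The corrected covariance in Joseph form. -/
lemma kalman_correction_eq_joseph (hP : P.PosSemidef) (hR : R.PosDef) :
    P - kalmanGain P C R * C * P =
      (1 - kalmanGain P C R * C) * P * (1 - kalmanGain P C R * C)ᵀ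
        + kalmanGain P C R * R * (kalmanGain P C R)ᵀ := by
  have hS : (R + C * P * Cᵀ).PosDef := hR.add_posSemidef (hP.conj C)
  set K := kalmanGain P C R with hK
  have hKS : K * (R + C * P * Cᵀ) = P * Cᵀ := by
    rw [hK, kalmanGain, Matrix.mul_assoc, hS.inv_mul_eq_one, Matrix.mul_one]
  have hKR : K * R = P * Cᵀ - K * (C * P * Cᵀ) := by
    rw [← hKS, Matrix.mul_add]; abel
  rw [hKR]
  simp only [Matrix.transpose_sub, Matrix.transpose_one, Matrix.transpose_mul, Matrix.mul_sub,
    Matrix.sub_mul, Matrix.mul_one, Matrix.one_mul, Matrix.mul_assoc]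
  abel

/-- The Joseph form is visibly a sum of two semidefinite terms. The information form would need an
invertible prior, which the initial covariance need not be. -/
lemma posSemidef_kalman_correction (hP : P.PosSemidef) (hR : R.PosDef) :
    (P - kalmanGain P C R * C * P).PosSemidef := by
  rw [kalman_correction_eq_joseph hP hR]
  exact (hP.conj _).add (hR.posSemidef.conj _)

/-- The corrected covariance in information form. -/
lemma kalman_correction_eq_inv (hP : P.PosDef) (hR : R.PosDef) :
    P - kalmanGain P C R * C * P = (P⁻¹ + Cᵀ * R⁻¹ * C)⁻¹ := by
  have hS : (R + C * P * Cᵀ).PosDef := hR.add_posSemidef (hP.posSemidef.conj C)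
  rw [Matrix.add_mul_mul_inv_eq_sub _ _ _ _ hP.inv.isUnit hR.inv.isUnit, hP.inv_inv_eq,
    hR.inv_inv_eq]
  · simp only [kalmanGain, Matrix.mul_assoc]
  · rw [hR.inv_inv_eq, hP.inv_inv_eq]
    exact hS.isUnit

/-- With $P^+$ the corrected covariance, $I-KC=P^+P^{-1}$, so the left side is the $P^+$-form at
$P^{-1}x$; and $P^+\le P$ because a measurement only adds information. -/
lemma quad_inv_correction_le (hP : P.PosDef) (hR : R.PosDef) (x : ι → ℝ) :
    quad (P - kalmanGain P C R * C * P)⁻¹ ((1 - kalmanGain P C R * C) *ᵥ x) ≤ quad P⁻¹ x := by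
  have hY : (P⁻¹ + Cᵀ * R⁻¹ * C).PosDef := hP.inv.add_posSemidef (posSemidef_information hR)
  have hpost : (P - kalmanGain P C R * C * P).PosDef := by
    rw [kalman_correction_eq_inv hP hR]; exact hY.inv
  have hx : (1 - kalmanGain P C R * C) *ᵥ x =
      (P - kalmanGain P C R * C * P) *ᵥ (P⁻¹ *ᵥ x) := by
    rw [Matrix.mulVec_mulVec, Matrix.sub_mul, Matrix.mul_assoc _ P, hP.mul_inv_eq_one,
      Matrix.mul_one]
  rw [hx, quad_inv_mulVec hpost, ← quad_mulVec_inv hP]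
  have := quad_inv_le hP.inv hY one_pos (fun z => by
    rw [quad_add, one_mul]
    have := (posSemidef_information (C := C) hR).quad_nonneg z
    linarith) (P⁻¹ *ᵥ x)
  rwa [← kalman_correction_eq_inv hP hR, hP.inv_inv_eq, one_mul] at this

omit [Fintype κ] [DecidableEq κ] in
-- Completion of the square: with $X=FPF^T+\Phi$ and $z=X^{-1}Fx$, expand the $P^{-1}$-form at
-- $x-PF^Tz$ and use $z^TFPF^Tz\le z^TXz$.
lemma quad_inv_predicted_le {F Φ : Matrix ι ι ℝ} (hΦ : Φ.PosDef) (hP : P.PosDef) (x : ι → ℝ) :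
    quad (F * P * Fᵀ + Φ)⁻¹ (F *ᵥ x) ≤ quad P⁻¹ x := by
  have hX := posDef_predicted (F := F) hΦ hP.posSemidef
  set X := F * P * Fᵀ + Φ with hXdef
  set z := X⁻¹ *ᵥ (F *ᵥ x) with hz
  have h1 := hP.inv.posSemidef.quad_nonneg (x + (-1 : ℝ) • P *ᵥ (Fᵀ *ᵥ z))
  rw [quad_add_vec hP.inv.posSemidef.transpose_eq, quad_smul_vec, quad_inv_mulVec hP,
    ← quad_conj] at h1
  have h2 : x ⬝ᵥ P⁻¹ *ᵥ ((-1 : ℝ) • P *ᵥ (Fᵀ *ᵥ z)) = - quad X⁻¹ (F *ᵥ x) := by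
    rw [Matrix.mulVec_smul, Matrix.mulVec_mulVec _ P⁻¹ P, hP.inv_mul_eq_one, Matrix.one_mulVec,
      dotProduct_smul, Matrix.mulVec_transpose, dotProduct_comm, ← Matrix.dotProduct_mulVec, quad,
      dotProduct_comm z]
    simp [hz]
  have h3 : quad X z = quad X⁻¹ (F *ᵥ x) := quad_mulVec_inv hX _
  have h4 : quad X z = quad (F * P * Fᵀ) z + quad Φ z := quad_add _ _ _
  have h5 := hΦ.posSemidef.quad_nonneg z
  rw [h2] at h1
  linarith

end Kalman

/-! ### Exponential stability -/

section Stability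

variable {ι : Type*} [Fintype ι] [DecidableEq ι]

lemma quad_one (x : ι → ℝ) : quad 1 x = ∑ i, x i ^ 2 := by
  simp [quad, dotProduct, sq]

lemma sq_norm_le_quad_one (x : ι → ℝ) : ‖x‖ ^ 2 ≤ quad 1 x := by
  have h0 : 0 ≤ quad 1 x := Matrix.PosSemidef.one.quad_nonneg x
  refine (Real.le_sqrt (norm_nonneg x) h0).1 ((pi_norm_le_iff_of_nonneg (Real.sqrt_nonneg _)).2
    fun i => Real.le_sqrt_of_sq_le ?_)
  rw [quad_one, Real.norm_eq_abs, sq_abs]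
  exact Finset.single_le_sum (f := fun i => x i ^ 2) (fun j _ => sq_nonneg _) (Finset.mem_univ i)

lemma quad_one_le (x : ι → ℝ) : quad 1 x ≤ Fintype.card ι * ‖x‖ ^ 2 := by
  rw [quad_one]
  have : ∀ i ∈ Finset.univ, x i ^ 2 ≤ ‖x‖ ^ 2 := fun i _ => by
    rw [← sq_abs]
    exact pow_le_pow_left₀ (abs_nonneg _) (norm_le_pi_norm x i) 2
  simpa using Finset.sum_le_sum this

omit [DecidableEq ι] in
lemma exists_quad_lt_of_inducedNorm_lt {W X : Matrix ι ι ℝ} (hW : W.PosDef) {b : ℝ}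
    (h : inducedNorm W X < b) :
    ∃ c : ℝ, 0 ≤ c ∧ c < b ∧ ∀ x, quad W (X *ᵥ x) ≤ c ^ 2 * quad W x := by
  obtain ⟨k, hk, hkle⟩ := exists_quad_le hW (Xᵀ * W * X)
  -- Nonemptiness matters: the infimum of the empty set of reals is $0$ by convention and would
  -- carry no information.
  have hne : {c : ℝ | 0 ≤ c ∧
      ∀ x : ι → ℝ, weightedNorm W (X *ᵥ x) ≤ c * weightedNorm W x}.Nonempty := by
    refine ⟨Real.sqrt k, Real.sqrt_nonneg _, fun x => ?_⟩
    rw [weightedNorm, weightedNorm, ← Real.sqrt_mul (by linarith)]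
    refine Real.sqrt_le_sqrt ?_
    have := hkle x
    rwa [quad_conj'] at this
  obtain ⟨c, ⟨hc0, hc⟩, hcb⟩ := exists_lt_of_csInf_lt hne h
  refine ⟨c, hc0, hcb, fun x => ?_⟩
  have h1 : √(quad W (X *ᵥ x)) ^ 2 ≤ (c * √(quad W x)) ^ 2 :=
    pow_le_pow_left₀ (Real.sqrt_nonneg _) (hc x) 2
  rw [mul_pow, Real.sq_sqrt (hW.posSemidef.quad_nonneg _),
    Real.sq_sqrt (hW.posSemidef.quad_nonneg _)] at h1
  exact h1

/-- A linear system that eventually contracts a fixed quadratic norm is exponentially stable. -/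
lemma exponentiallyStable_of_eventually_contracting {F : ℕ → Matrix ι ι ℝ} {W : Matrix ι ι ℝ}
    (hW : W.PosDef) {β : ℝ} (hβ : 0 < β) (hβ1 : β < 1)
    (h : ∀ᶠ q in atTop, ∀ x, quad W (F q *ᵥ x) ≤ β ^ 2 * quad W x) :
    ExponentiallyStable F := by
  obtain ⟨q₀, hq₀⟩ := eventually_atTop.1 h
  have hex : ∀ q, ∃ a : ℝ, 1 ≤ a ∧ (q₀ ≤ q → a = 1) ∧
      ∀ x, quad W (F q *ᵥ x) ≤ a * (β ^ 2 * quad W x) := fun q => by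
    rcases le_or_gt q₀ q with hq | hq
    · exact ⟨1, le_rfl, fun _ => rfl, fun x => by simpa using hq₀ q hq x⟩
    · obtain ⟨k, hk, hkle⟩ := exists_quad_le (hW.smul (pow_pos hβ 2)) ((F q)ᵀ * W * F q)
      refine ⟨k, hk, fun h' => absurd h' (not_le.2 hq), fun x => ?_⟩
      have := hkle x
      rwa [quad_conj', quad_smul] at this
  choose a ha1 haq hale using hex
  -- The product collects the possible growth still to come before time $q_0$ and is $1$ afterwards.
  -- Weighted by it, the $W$-form decays by $\beta^2$ at every step, and $A_q\le A_0$ makes the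
  -- constant uniform in $q$.
  let A : ℕ → ℝ := fun q => ∏ j ∈ Finset.Ico q q₀, a j
  have hA1 : ∀ q, 1 ≤ A q := fun q =>
    Finset.prod_induction a (1 ≤ ·) (fun _ _ => one_le_mul_of_one_le_of_one_le) le_rfl
      fun j _ => ha1 j
  have hAsucc : ∀ q, A q = a q * A (q + 1) := fun q => by
    rcases le_or_gt q₀ q with hq | hq
    · simp [A, Finset.Ico_eq_empty_of_le hq, Finset.Ico_eq_empty_of_le (hq.trans (Nat.le_succ q)),
        haq q hq]
    · exact Finset.prod_eq_prod_Ico_succ_bot hq _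
  have hA0 : ∀ q, A q ≤ A 0 := fun q =>
    antitone_nat_of_succ_le (fun j => by
      rw [hAsucc j]
      nlinarith [ha1 j, hA1 (j + 1)]) (Nat.zero_le q)
  obtain ⟨c₁, hc₁, hle₁⟩ := exists_quad_le hW (1 : Matrix ι ι ℝ)
  obtain ⟨c₂, hc₂, hle₂⟩ := exists_quad_le (Matrix.PosDef.one : (1 : Matrix ι ι ℝ).PosDef) W
  -- The summand $1$ keeps $c\ge1$ even for an empty index type; $c\le c^2$ then avoids a square
  -- root in the final constant.
  set c : ℝ := c₁ * (A 0 * (c₂ * (Fintype.card ι + 1))) with hc_def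
  have hc1 : 1 ≤ c := by
    have h1 : (1 : ℝ) ≤ Fintype.card ι + 1 := by
      have : (0 : ℝ) ≤ Fintype.card ι := Nat.cast_nonneg _
      linarith
    exact one_le_mul_of_one_le_of_one_le hc₁ (one_le_mul_of_one_le_of_one_le (hA1 0)
      (one_le_mul_of_one_le_of_one_le hc₂ h1))
  refine ⟨c, β, by linarith, hβ, hβ1, fun q e he k => ?_⟩
  have hV : A (q + k) * quad W (e k) ≤ (β ^ 2) ^ k * (A q * quad W (e 0)) := by
    induction k with
    | zero => simp
    | succ k ih =>
      have h1 := mul_le_mul_of_nonneg_left (hale (q + k) (e k))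
        (zero_le_one.trans (hA1 (q + k + 1)))
      rw [← he] at h1
      have h2 := mul_le_mul_of_nonneg_left ih (sq_nonneg β)
      calc A (q + (k + 1)) * quad W (e (k + 1))
          ≤ A (q + k + 1) * (a (q + k) * (β ^ 2 * quad W (e k))) := h1
        _ = β ^ 2 * (A (q + k) * quad W (e k)) := by rw [hAsucc (q + k)]; ring
        _ ≤ β ^ 2 * ((β ^ 2) ^ k * (A q * quad W (e 0))) := h2
        _ = (β ^ 2) ^ (k + 1) * (A q * quad W (e 0)) := by ring
  have hq0 := hW.posSemidef.quad_nonneg (e 0)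
  have hqk := hW.posSemidef.quad_nonneg (e k)
  have hW0 : quad W (e 0) ≤ c₂ * (Fintype.card ι + 1) * ‖e 0‖ ^ 2 := by
    have h1 := (hle₂ (e 0)).trans (mul_le_mul_of_nonneg_left (quad_one_le (e 0)) (by linarith))
    have h2 : 0 ≤ c₂ * ‖e 0‖ ^ 2 := by positivity
    linarith
  have hA00 : 0 ≤ A 0 := zero_le_one.trans (hA1 0)
  have hsq : ‖e k‖ ^ 2 ≤ c * ((β ^ 2) ^ k * ‖e 0‖ ^ 2) :=
    calc ‖e k‖ ^ 2 ≤ quad 1 (e k) := sq_norm_le_quad_one _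
      _ ≤ c₁ * quad W (e k) := hle₁ _
      _ ≤ c₁ * (A (q + k) * quad W (e k)) :=
        mul_le_mul_of_nonneg_left (le_mul_of_one_le_left hqk (hA1 _)) (by linarith)
      _ ≤ c₁ * ((β ^ 2) ^ k * (A q * quad W (e 0))) :=
        mul_le_mul_of_nonneg_left hV (by linarith)
      _ ≤ c₁ * ((β ^ 2) ^ k * (A 0 * (c₂ * (Fintype.card ι + 1) * ‖e 0‖ ^ 2))) := by
        have := mul_le_mul (hA0 q) hW0 hq0 hA00
        gcongr
      _ = c * ((β ^ 2) ^ k * ‖e 0‖ ^ 2) := by rw [hc_def]; ring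
  refine abs_le_of_sq_le_sq' ?_ (by positivity) |>.2
  calc ‖e k‖ ^ 2 ≤ c * ((β ^ 2) ^ k * ‖e 0‖ ^ 2) := hsq
    _ ≤ c ^ 2 * ((β ^ 2) ^ k * ‖e 0‖ ^ 2) := by
      have : c ≤ c ^ 2 := by nlinarith
      gcongr
    _ = (c * β ^ k * ‖e 0‖) ^ 2 := by rw [← pow_mul, mul_comm 2 k, pow_mul]; ring

end Stability

/-! ### Block-diagonal matrices -/

section BlockDiagonal

variable {o : Type*} [Fintype o] [DecidableEq o] {a b : o → Type*} [∀ m, Fintype (a m)]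
  [∀ m, Fintype (b m)] [∀ m, DecidableEq (a m)]

omit [∀ m, Fintype (a m)] [∀ m, DecidableEq (a m)] in
lemma blockDiagonal'_mulVec (M : ∀ m, Matrix (a m) (b m) ℝ) (x : (Σ m, b m) → ℝ) (i : Σ m, a m) :
    (Matrix.blockDiagonal' M *ᵥ x) i = (M i.1 *ᵥ fun k => x ⟨i.1, k⟩) i.2 := by
  obtain ⟨m, i⟩ := i
  simp only [Matrix.mulVec, dotProduct, Fintype.sum_sigma]
  rw [Finset.sum_eq_single m]
  · simp [Matrix.blockDiagonal'_apply_eq]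
  · intro j _ hj
    simp [Matrix.blockDiagonal'_apply_ne M i _ hj.symm]
  · simp

omit [∀ m, DecidableEq (a m)] in
lemma quad_blockDiagonal' (M : ∀ m, Matrix (a m) (a m) ℝ) (x : (Σ m, a m) → ℝ) :
    quad (Matrix.blockDiagonal' M) x = ∑ m, quad (M m) fun i => x ⟨m, i⟩ := by
  simp only [quad, dotProduct, Fintype.sum_sigma, blockDiagonal'_mulVec]

omit [∀ m, DecidableEq (a m)] in
lemma posSemidef_blockDiagonal' {M : ∀ m, Matrix (a m) (a m) ℝ} (hM : ∀ m, (M m).PosSemidef) :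
    (Matrix.blockDiagonal' M).PosSemidef := by
  refine posSemidef_iff_quad.2 ⟨?_, fun x => ?_⟩
  · rw [Matrix.blockDiagonal'_transpose]
    simp only [(hM _).transpose_eq]
  · rw [quad_blockDiagonal']
    exact Finset.sum_nonneg fun m _ => (hM m).quad_nonneg _

omit [Fintype o] [∀ m, Fintype (a m)] [∀ m, DecidableEq (a m)] in
lemma posDef_of_posDef_blockDiagonal' {M : ∀ m, Matrix (a m) (a m) ℝ}
    (hM : (Matrix.blockDiagonal' M).PosDef) (m : o) : (M m).PosDef := by
  have h := hM.submatrix (e := Sigma.mk m) sigma_mk_injective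
  have hsub : (Matrix.blockDiagonal' M).submatrix (Sigma.mk m) (Sigma.mk m) = M m := by
    ext i j
    simp [Matrix.blockDiagonal'_apply_eq]
  rwa [hsub] at h

lemma blockDiagonal'_inv {M : ∀ m, Matrix (a m) (a m) ℝ} (hM : ∀ m, (M m).PosDef) :
    (Matrix.blockDiagonal' M)⁻¹ = Matrix.blockDiagonal' fun m => (M m)⁻¹ := by
  refine Matrix.inv_eq_right_inv ?_
  rw [← Matrix.blockDiagonal'_mul]
  simp only [(hM _).mul_inv_eq_one]
  exact Matrix.blockDiagonal'_one

omit [∀ m, DecidableEq (a m)] in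
-- Identifies the node gains with the gain of one global filter, so that the single-system lemmas
-- apply to the network.
lemma kalmanGain_blockDiagonal' [∀ m, DecidableEq (b m)] {P : ∀ m, Matrix (a m) (a m) ℝ}
    {C : ∀ m, Matrix (b m) (a m) ℝ} {R : ∀ m, Matrix (b m) (b m) ℝ}
    (hP : ∀ m, (P m).PosSemidef) (hR : ∀ m, (R m).PosDef) :
    kalmanGain (Matrix.blockDiagonal' P) (Matrix.blockDiagonal' C) (Matrix.blockDiagonal' R) =
      Matrix.blockDiagonal' fun m => kalmanGain (P m) (C m) (R m) := by
  have hS : ∀ m, ((R + fun m => C m * P m * (C m)ᵀ) m).PosDef := fun m =>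
    (hR m).add_posSemidef ((hP m).conj (C m))
  simp only [kalmanGain]
  rw [Matrix.blockDiagonal'_transpose, ← Matrix.blockDiagonal'_mul, ← Matrix.blockDiagonal'_mul,
    ← Matrix.blockDiagonal'_mul, ← Matrix.blockDiagonal'_add, blockDiagonal'_inv hS,
    ← Matrix.blockDiagonal'_mul]
  rfl

end BlockDiagonal

/-! ### The finite-element model -/

namespace FEModel

variable {d n N : ℕ} {V W : Type*} [NormedAddCommGroup V] [InnerProductSpace ℝ V]
  [CompleteSpace V] [AddCommGroup W] [Module ℝ W] (D : FEModel d n N V W)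

/-- This is the Gram matrix of the basis in $L^2$, where independence survives because `toL2` is
injective. -/
lemma posDef_mass : D.mass.PosDef := by
  have hli : LinearIndependent ℝ (D.toL2 ∘ D.basis) :=
    D.basis_indep.map' D.toL2 (LinearMap.ker_eq_bot.2 D.toL2_injective)
  have hgram := Matrix.posDef_gram_of_linearIndependent hli
  have : D.mass = Matrix.gram ℝ (D.toL2 ∘ D.basis) := by
    ext i j
    simp only [mass, Matrix.of_apply, Matrix.gram_apply, Function.comp_apply, L2.inner_def]
    refine integral_congr_ae (Eventually.of_forall fun p => ?_)
    simp [mul_comm]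
  rwa [this]

lemma quad_stiffness (x : Fin n → ℝ) :
    quad D.stiffness x = D.op (∑ i, x i • D.basis i) (∑ i, x i • D.basis i) := by
  simp only [quad, dotProduct, Matrix.mulVec, stiffness, Matrix.of_apply, map_sum, map_smul,
    LinearMap.sum_apply, LinearMap.smul_apply, smul_eq_mul, Finset.mul_sum]
  refine Finset.sum_congr rfl fun i _ => Finset.sum_congr rfl fun j _ => ?_
  ring

/-- Coercivity applies because every combination of basis functions satisfies the essential boundary
conditions; independence makes a nontrivial combination nonzero. -/
lemma posDef_stiffness (hA1 : D.A1) : D.stiffness.PosDef := by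
  obtain ⟨-, c, hc, hcoer⟩ := hA1
  refine posDef_iff_quad.2 ⟨?_, fun x hx => ?_⟩
  · ext i j
    simp only [stiffness, Matrix.transpose_apply, Matrix.of_apply]
    exact D.op_symm _ _
  · rw [quad_stiffness]
    have hb : D.bdry (∑ i, x i • D.basis i) = 0 := by simp [D.basis_bdry]
    have hne : ∑ i, x i • D.basis i ≠ 0 := fun h0 =>
      hx (funext fun i => Fintype.linearIndependent_iff.1 D.basis_indep x h0 i)
    have := norm_pos_iff.2 hne
    exact lt_of_lt_of_le (by positivity) (hcoer _ hb)

lemma posDef_diagBlock {X : Matrix (Fin n) (Fin n) ℝ} (hX : X.PosDef) (m : Fin N) :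
    (D.diagBlock X m).PosDef :=
  hX.submatrix Subtype.val_injective

variable {δ : ℝ}

lemma posDef_local (hA1 : D.A1) (hδ : 0 < δ) (m : Fin N) :
    (D.diagBlock D.mass m + δ • D.diagBlock D.stiffness m).PosDef :=
  (D.posDef_diagBlock D.posDef_mass m).add
    ((D.posDef_diagBlock (D.posDef_stiffness hA1) m).smul hδ)

lemma inv_augD (hA1 : D.A1) (hδ : 0 < δ) :
    (D.augD D.mass + δ • D.augD D.stiffness)⁻¹ = Matrix.blockDiagonal' fun m =>
      (D.diagBlock D.mass m + δ • D.diagBlock D.stiffness m)⁻¹ := by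
  rw [← blockDiagonal'_inv (D.posDef_local hA1 hδ), augD, augD, ← Matrix.blockDiagonal'_smul,
    ← Matrix.blockDiagonal'_add]
  rfl

lemma AD_eq_blockDiagonal' (hA1 : D.A1) (hδ : 0 < δ) :
    D.AD δ = Matrix.blockDiagonal' (D.Aloc δ) := by
  rw [AD, D.inv_augD hA1 hδ, augD, ← Matrix.blockDiagonal'_mul]
  rfl

lemma isUnit_Aloc (hA1 : D.A1) (hδ : 0 < δ) (m : Fin N) : IsUnit (D.Aloc δ m) :=
  (D.posDef_local hA1 hδ m).inv.isUnit.mul (D.posDef_diagBlock D.posDef_mass m).isUnit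

lemma isUnit_AD (hA1 : D.A1) (hδ : 0 < δ) : IsUnit (D.AD δ) := by
  have h1 : ∀ m, (D.Aloc δ m) * (D.Aloc δ m)⁻¹ = 1 := fun m =>
    Matrix.mul_nonsing_inv _ ((Matrix.isUnit_iff_isUnit_det _).1 (D.isUnit_Aloc hA1 hδ m))
  refine IsUnit.of_mul_eq_one (Matrix.blockDiagonal' fun m => (D.Aloc δ m)⁻¹) ?_
  rw [D.AD_eq_blockDiagonal' hA1 hδ, ← Matrix.blockDiagonal'_mul]
  simp only [h1]
  exact Matrix.blockDiagonal'_one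

/-- Reconciles the local sums over neighbours with the global interconnection matrix, which runs
over all other nodes. -/
lemma couplingBlock_eq_zero (X : Matrix (Fin n) (Fin n) ℝ) {m j : Fin N} (h : ¬(D.Γ m j).Nonempty) :
    D.couplingBlock X m j = 0 := by
  rw [Set.not_nonempty_iff_eq_empty] at h
  ext i k
  simp [couplingBlock, h]

lemma augF_mulVec_col (X : Matrix (Fin n) (Fin n) ℝ) (y : D.NodeStates) :
    D.augF X *ᵥ D.col y =
      D.col fun m => ∑ j ∈ D.neighbors m, D.couplingBlock X m j *ᵥ y j := by
  ext ⟨m, i⟩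
  simp only [Matrix.mulVec, dotProduct, Fintype.sum_sigma, col, augF, Matrix.of_apply,
    Finset.sum_apply]
  rw [neighbors, Finset.sum_filter]
  refine Finset.sum_congr rfl fun j _ => ?_
  by_cases hj : j = m
  · simp [hj]
  by_cases hΓ : (D.Γ m j).Nonempty
  · simp [hj, hΓ]
  · simp [hj, hΓ, D.couplingBlock_eq_zero X hΓ]

lemma blockDiagonal'_mulVec_col {a : Fin N → Type} (M : ∀ m, Matrix (a m) (D.internal m) ℝ)
    (y : D.NodeStates) :
    Matrix.blockDiagonal' M *ᵥ D.col y = fun i : Σ m, a m => (M i.1 *ᵥ y i.1) i.2 :=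
  funext fun i => blockDiagonal'_mulVec (b := fun m => D.internal m) M (D.col y) i

lemma AF_mulVec_col (hA1 : D.A1) (hδ : 0 < δ) (y : D.NodeStates) :
    D.AF δ *ᵥ D.col y = D.col fun m => ∑ j ∈ D.neighbors m, D.Acpl δ m j *ᵥ y j := by
  have h : (-(δ • D.augF D.stiffness) - D.augF D.mass) *ᵥ D.col y =
      D.col fun m => ∑ j ∈ D.neighbors m,
        (-(δ • D.couplingBlock D.stiffness m j) - D.couplingBlock D.mass m j) *ᵥ y j := by
    rw [Matrix.sub_mulVec, Matrix.neg_mulVec, Matrix.smul_mulVec, augF_mulVec_col,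
      augF_mulVec_col]
    ext i
    simp [col, Matrix.sub_mulVec, Matrix.neg_mulVec, Matrix.smul_mulVec, Finset.mul_sum]
  rw [AF, ← Matrix.mulVec_mulVec, h, D.inv_augD hA1 hδ, blockDiagonal'_mulVec_col]
  ext i
  simp only [col, Acpl, Matrix.mulVec_sum, Matrix.mulVec_mulVec]

lemma AFbar_mulVec_col (hA1 : D.A1) (hδ : 0 < δ) (y : D.NodeStates) :
    D.AFbar δ *ᵥ D.col y = D.col fun m => ∑ j ∈ D.neighbors m, D.Abar δ m j *ᵥ y j := by
  rw [AFbar, ← Matrix.mulVec_mulVec, augF_mulVec_col, D.inv_augD hA1 hδ,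
    blockDiagonal'_mulVec_col]
  ext i
  simp only [col, Abar, Matrix.mulVec_sum, Matrix.mulVec_mulVec]

lemma col_schwarz_succ (hA1 : D.A1) (hδ : 0 < δ) (x : D.NodeStates) (g : ℕ → D.NodeStates)
    (l : ℕ) :
    D.col (D.schwarz δ x g (l + 1)).2 =
      (D.AD δ + D.AF δ) *ᵥ D.col (D.schwarz δ x g l).2
        + D.AFbar δ *ᵥ D.col (D.schwarz δ x g l).1 + D.col (g (l + 1)) := by
  rw [Matrix.add_mulVec, D.AF_mulVec_col hA1 hδ, D.AFbar_mulVec_col hA1 hδ,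
    D.AD_eq_blockDiagonal' hA1 hδ, blockDiagonal'_mulVec_col]
  rfl

/-- Superposition for the recursion in `ℓ`. -/
lemma col_schwarz_sub (hA1 : D.A1) (hδ : 0 < δ) (x x' : D.NodeStates) (g w : ℕ → D.NodeStates)
    (l : ℕ) :
    (D.col (D.schwarz δ x (fun l m => g l m + w l m) l).1 - D.col (D.schwarz δ x' g l).1 =
      (D.transition δ l).1 *ᵥ (D.col x - D.col x')
        + D.col (D.schwarz δ (fun _ _ => 0) w l).1) ∧
    (D.col (D.schwarz δ x (fun l m => g l m + w l m) l).2 - D.col (D.schwarz δ x' g l).2 =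
      (D.transition δ l).2 *ᵥ (D.col x - D.col x')
        + D.col (D.schwarz δ (fun _ _ => 0) w l).2) := by
  induction l with
  | zero =>
    have h0 : D.col (fun _ _ => 0) = 0 := rfl
    simp [schwarz, transition, h0]
  | succ l ih =>
    refine ⟨ih.2, ?_⟩
    have hg : D.col (fun m => g (l + 1) m + w (l + 1) m) =
        D.col (g (l + 1)) + D.col (w (l + 1)) := rfl
    rw [col_schwarz_succ D hA1 hδ, col_schwarz_succ D hA1 hδ, col_schwarz_succ D hA1 hδ, hg,
      sub_eq_iff_eq_add.1 ih.1, sub_eq_iff_eq_add.1 ih.2]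
    simp only [transition, Matrix.add_mulVec, Matrix.mulVec_add, ← Matrix.mulVec_mulVec]
    abel

end FEModel

/-! ### The distributed filter -/

namespace FEFilter

variable {d n N : ℕ} {V W : Type*} [NormedAddCommGroup V] [InnerProductSpace ℝ V]
  [CompleteSpace V] [AddCommGroup W] [Module ℝ W] {D : FEModel d n N V W} {r : Fin N → ℕ}
  {E : FEFilter D r} {C : ∀ m, Matrix (Fin (r m)) (D.internal m) ℝ}

/-- A linear map is its own derivative; hence gains and covariances no longer depend on the
estimates or the data. -/
lemma jac_eq (hA2 : E.A2 C) (m : Fin N) (x : D.internal m → ℝ) : E.jac m x = C m := by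
  have h : E.h m = ⇑(LinearMap.toContinuousLinearMap (Matrix.toLin' (C m))) :=
    funext fun z => hA2.1 m z
  rw [jac, h, ContinuousLinearMap.fderiv]
  simp

/-- The term $i=0$ is $\tilde Q$ itself, present because $L\ge1$; the others are semidefinite. -/
lemma posDef_Phi (hQ : E.Qglob.PosDef) : E.Phi.PosDef := by
  obtain ⟨l, hl⟩ := Nat.exists_eq_succ_of_ne_zero E.L_pos.ne'
  rw [Phi, hl, Finset.sum_range_succ']
  refine Matrix.PosDef.posSemidef_add (Matrix.posSemidef_sum _ fun i _ =>
    (hQ.posSemidef.conj _).smul (pow_nonneg (zero_le_one.trans E.one_le_γ) _)) ?_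
  simpa using hQ

lemma blockDiagonal'_covIter (hA1 : D.A1) (P : ∀ m, Matrix (D.internal m) (D.internal m) ℝ)
    (l : ℕ) :
    Matrix.blockDiagonal' (fun m => E.covIter m (P m) l) =
      E.γ ^ (2 * l) • (D.AD E.δ ^ l * Matrix.blockDiagonal' P * (D.AD E.δ ^ l)ᵀ)
        + ∑ i ∈ Finset.range l, E.γ ^ (2 * i) •
          (D.AD E.δ ^ i * E.Qglob * (D.AD E.δ ^ i)ᵀ) := by
  induction l with
  | zero => simp [covIter]
  | succ l ih =>
    have hstep : Matrix.blockDiagonal' (fun m => E.covIter m (P m) (l + 1)) =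
        E.γ ^ 2 • (D.AD E.δ * Matrix.blockDiagonal' (fun m => E.covIter m (P m) l)
          * (D.AD E.δ)ᵀ) + E.Qglob := by
      rw [D.AD_eq_blockDiagonal' hA1 E.δ_pos, Matrix.blockDiagonal'_transpose,
        ← Matrix.blockDiagonal'_mul, ← Matrix.blockDiagonal'_mul, ← Matrix.blockDiagonal'_smul,
        Qglob, ← Matrix.blockDiagonal'_add]
      rfl
    rw [hstep, ih, Finset.sum_range_succ']
    simp only [Matrix.mul_add, Matrix.add_mul, smul_add, Matrix.mul_sum, Matrix.sum_mul,
      Finset.smul_sum, Matrix.mul_smul, Matrix.smul_mul, smul_smul, pow_succ' (D.AD E.δ),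
      Matrix.transpose_mul, Matrix.mul_assoc, ← pow_add]
    have h2 : ∀ i, 2 * (i + 1) = 2 + 2 * i := fun i => by ring
    simp only [h2, mul_zero, pow_zero, one_smul, Matrix.one_mul, Matrix.transpose_one,
      Matrix.mul_one, add_assoc]

variable (E) in
/-- The transition matrix `γ^L Ã_D^L` of the covariance recursion. -/
def covTransition : Matrix D.GlobalIdx D.GlobalIdx ℝ := E.γ ^ E.L • D.AD E.δ ^ E.L

variable (E C) in
/-- The information gain `C̃ᵀ R̃⁻¹ C̃` of a measurement. -/
def infoGain : Matrix D.GlobalIdx D.GlobalIdx ℝ :=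
  (Matrix.blockDiagonal' C)ᵀ * (E.Rglob)⁻¹ * Matrix.blockDiagonal' C

lemma posSemidef_infoGain (hR : E.Rglob.PosDef) : (E.infoGain C).PosSemidef :=
  posSemidef_information hR

lemma covTransition_conj (P : Matrix D.GlobalIdx D.GlobalIdx ℝ) :
    E.covTransition * P * E.covTransitionᵀ =
      E.γ ^ (2 * E.L) • (D.AD E.δ ^ E.L * P * (D.AD E.δ ^ E.L)ᵀ) := by
  simp only [covTransition, Matrix.transpose_smul, Matrix.smul_mul, Matrix.mul_smul, smul_smul,
    ← pow_add, two_mul]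

lemma γ_pow_pos : 0 < E.γ ^ E.L := pow_pos (zero_lt_one.trans_le E.one_le_γ) _

lemma isUnit_covTransition (hA1 : D.A1) : IsUnit E.covTransition := by
  have h := (D.isUnit_AD hA1 E.δ_pos).pow E.L
  exact h.smul (Units.mk0 _ (γ_pow_pos (E := E)).ne')

lemma riccati_iff (hQ : E.Qglob.PosDef) (hR : E.Rglob.PosDef)
    {P : Matrix D.GlobalIdx D.GlobalIdx ℝ} (hP : P.PosDef) :
    E.Riccati C P ↔ riccatiStep E.covTransition E.Phi (E.infoGain C) P = P := by
  have hY := posDef_information (F := E.covTransition) (posDef_Phi hQ)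
    (posSemidef_infoGain (C := C) hR) hP.posSemidef
  rw [Riccati, riccatiStep, ← covTransition_conj]
  constructor
  · intro h
    rw [infoGain, ← h, hP.inv_inv_eq]
  · intro h
    rw [← h, hY.inv_inv_eq, h]
    rfl

end FEFilter

/-! ### Backward observability, the covariance orbit and the error dynamics -/

namespace FEFilter

variable {d n N : ℕ} {V W : Type*} [NormedAddCommGroup V] [InnerProductSpace ℝ V]
  [CompleteSpace V] [AddCommGroup W] [Module ℝ W] {D : FEModel d n N V W} {r : Fin N → ℕ}
  {E : FEFilter D r} {C : ∀ m, Matrix (Fin (r m)) (D.internal m) ℝ}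

lemma AD_pow_mulVec (hA1 : D.A1) (k : ℕ) (x : D.GlobalIdx → ℝ) (m : Fin N) :
    (fun i => (D.AD E.δ ^ k *ᵥ x) ⟨m, i⟩) = D.Aloc E.δ m ^ k *ᵥ fun i => x ⟨m, i⟩ := by
  rw [D.AD_eq_blockDiagonal' hA1 E.δ_pos, ← Matrix.blockDiagonal'_pow]
  funext i
  exact blockDiagonal'_mulVec (a := fun m => D.internal m) (b := fun m => D.internal m) _ x ⟨m, i⟩

/-- Local observability makes the backward global system observable. -/
lemma eq_zero_of_quad_infoGain_eq_zero (hA1 : D.A1) (hA2 : E.A2 C) (hR : E.Rglob.PosDef)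
    (x : D.GlobalIdx → ℝ)
    (hx : ∀ i < Fintype.card D.GlobalIdx,
      quad (E.infoGain C) ((E.covTransition⁻¹ ^ i) *ᵥ x) = 0) : x = 0 := by
  set F := E.covTransition with hFdef
  have hF : IsUnit F := isUnit_covTransition hA1
  set k := Fintype.card D.GlobalIdx with hk
  -- From the farthest backward point $z$, the vanishing backward outputs of $x$ become forward
  -- outputs, to which the local observability assumption applies.
  set z := F⁻¹ ^ (k - 1) *ᵥ x with hz
  have hC : ∀ i < k, Matrix.blockDiagonal' C *ᵥ (F⁻¹ ^ i *ᵥ x) = 0 := fun i hi => by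
    have h := hx i hi
    rw [infoGain, quad_conj'] at h
    by_contra hne
    exact ((posDef_iff_quad.1 hR.inv).2 _ hne).ne' h
  have hz0 : z = 0 := by
    have hloc : ∀ m, (fun i => z ⟨m, i⟩) = 0 := fun m => by
      refine hA2.2 m _ fun j hj => ?_
      -- A local dimension is at most the global one, so the $k$ known outputs cover every local
      -- observability test.
      have hjk : j < k := hj.trans_le (Fintype.card_le_of_injective _
        (sigma_mk_injective (β := fun m => D.internal m) (i := m)))
      have h1 := hC (k - 1 - j) (by omega)
      rw [← pow_mul_inv_pow_add hF j, show j + (k - 1 - j) = k - 1 by omega,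
        ← Matrix.mulVec_mulVec, ← hz, hFdef, covTransition, smul_pow, Matrix.smul_mulVec,
        Matrix.mulVec_smul] at h1
      have h2 := (smul_eq_zero.1 h1).resolve_left (pow_pos (γ_pow_pos (E := E)) j).ne'
      rw [← Matrix.mulVec_mulVec, ← pow_mul, ← AD_pow_mulVec hA1, pow_mul]
      funext i
      have h3 := congrFun h2 ⟨m, i⟩
      rw [blockDiagonal'_mulVec (b := fun m => D.internal m)] at h3
      exact h3
    funext ⟨m, i⟩
    exact congrFun (hloc m) i
  have h1 : F ^ (k - 1) *ᵥ z = x := by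
    rw [hz, Matrix.mulVec_mulVec]
    have := pow_mul_inv_pow_add hF (k - 1) 0
    rw [add_zero] at this
    rw [this, pow_zero, Matrix.one_mulVec]
  rw [← h1, hz0, Matrix.mulVec_zero]

section Run

variable {s₀ : State D} {y : ℕ → ∀ m, Fin (r m) → ℝ} {u : ℕ → ℕ → D.NodeStates}

variable (E s₀ y u) in
/-- The global prior covariance `block-diag (P^1_{q|q-1}, …, P^N_{q|q-1})`. -/
def globalPriorCov (q : ℕ) : Matrix D.GlobalIdx D.GlobalIdx ℝ :=
  Matrix.blockDiagonal' (E.prior s₀ y u q).cov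

lemma posDef_R (hR : E.Rglob.PosDef) (m : Fin N) : (E.R m).PosDef :=
  posDef_of_posDef_blockDiagonal' hR m

lemma gain_eq (hA2 : E.A2 C) (s : State D) (m : Fin N) :
    E.gain s m = kalmanGain (s.cov m) (C m) (E.R m) := by
  rw [gain, jac_eq hA2]

lemma posSemidef_correct (hA2 : E.A2 C) (hR : E.Rglob.PosDef) {s : State D}
    (hs : ∀ m, (s.cov m).PosSemidef) (z : ∀ m, Fin (r m) → ℝ) (m : Fin N) :
    ((E.correct s z).cov m).PosSemidef := by
  simp only [correct, gain_eq hA2, jac_eq hA2]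
  exact posSemidef_kalman_correction (hs m) (posDef_R hR m)

lemma globalPriorCov_succ (hA1 : D.A1) (q : ℕ) :
    E.globalPriorCov s₀ y u (q + 1) =
      E.covTransition * E.globalCov s₀ y u q * E.covTransitionᵀ + E.Phi := by
  rw [covTransition_conj]
  exact blockDiagonal'_covIter hA1 _ E.L

lemma posSemidef_prior (hA1 : D.A1) (hA2 : E.A2 C) (hQ : E.Qglob.PosDef) (hR : E.Rglob.PosDef)
    (hs₀ : ∀ m, (s₀.cov m).PosSemidef) (q : ℕ) (m : Fin N) :
    ((E.prior s₀ y u q).cov m).PosSemidef := by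
  induction q generalizing m with
  | zero => exact hs₀ m
  | succ q ih =>
    have h : (E.globalPriorCov s₀ y u (q + 1)).PosDef := by
      rw [globalPriorCov_succ hA1]
      exact posDef_predicted (posDef_Phi hQ)
        (posSemidef_blockDiagonal' fun m => posSemidef_correct hA2 hR ih (y q) m)
    exact (posDef_of_posDef_blockDiagonal' h m).posSemidef

lemma posSemidef_globalCov (hA1 : D.A1) (hA2 : E.A2 C) (hQ : E.Qglob.PosDef)
    (hR : E.Rglob.PosDef) (hs₀ : ∀ m, (s₀.cov m).PosSemidef) (q : ℕ) :
    (E.globalCov s₀ y u q).PosSemidef :=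
  posSemidef_blockDiagonal' fun m =>
    posSemidef_correct hA2 hR (posSemidef_prior hA1 hA2 hQ hR hs₀ q) (y q) m

lemma globalGain_eq (hA1 : D.A1) (hA2 : E.A2 C) (hQ : E.Qglob.PosDef) (hR : E.Rglob.PosDef)
    (hs₀ : ∀ m, (s₀.cov m).PosSemidef) (q : ℕ) :
    E.globalGain s₀ y u q =
      kalmanGain (E.globalPriorCov s₀ y u q) (Matrix.blockDiagonal' C) E.Rglob := by
  rw [globalPriorCov, Rglob,
    kalmanGain_blockDiagonal' (posSemidef_prior hA1 hA2 hQ hR hs₀ q) (posDef_R hR), globalGain]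
  congr 1
  exact funext fun m => gain_eq hA2 _ m

lemma globalCov_eq (hA1 : D.A1) (hA2 : E.A2 C) (hQ : E.Qglob.PosDef) (hR : E.Rglob.PosDef)
    (hs₀ : ∀ m, (s₀.cov m).PosSemidef) (q : ℕ) :
    E.globalCov s₀ y u q = E.globalPriorCov s₀ y u q -
      kalmanGain (E.globalPriorCov s₀ y u q) (Matrix.blockDiagonal' C) E.Rglob *
        Matrix.blockDiagonal' C * E.globalPriorCov s₀ y u q := by
  rw [← globalGain_eq hA1 hA2 hQ hR hs₀, globalPriorCov, globalGain, ← Matrix.blockDiagonal'_mul,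
    ← Matrix.blockDiagonal'_mul, ← Matrix.blockDiagonal'_sub, globalCov]
  congr 1
  funext m
  simp only [posterior, correct, jac_eq hA2, Pi.sub_apply]

lemma posDef_globalPriorCov_succ (hA1 : D.A1) (hA2 : E.A2 C) (hQ : E.Qglob.PosDef)
    (hR : E.Rglob.PosDef) (hs₀ : ∀ m, (s₀.cov m).PosSemidef) (q : ℕ) :
    (E.globalPriorCov s₀ y u (q + 1)).PosDef := by
  rw [globalPriorCov_succ hA1]
  exact posDef_predicted (posDef_Phi hQ) (posSemidef_globalCov hA1 hA2 hQ hR hs₀ q)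

lemma globalCov_succ (hA1 : D.A1) (hA2 : E.A2 C) (hQ : E.Qglob.PosDef) (hR : E.Rglob.PosDef)
    (hs₀ : ∀ m, (s₀.cov m).PosSemidef) (q : ℕ) :
    E.globalCov s₀ y u (q + 1) =
      riccatiStep E.covTransition E.Phi (E.infoGain C) (E.globalCov s₀ y u q) := by
  rw [globalCov_eq hA1 hA2 hQ hR hs₀, kalman_correction_eq_inv
    (posDef_globalPriorCov_succ hA1 hA2 hQ hR hs₀ q) hR, globalPriorCov_succ hA1]
  rfl

/-- The shift by one is needed because the first posterior covariance may be singular; one Riccati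
step makes it positive definite. -/
lemma isRiccatiOrbit_globalCov (hA1 : D.A1) (hA2 : E.A2 C) (hQ : E.Qglob.PosDef)
    (hR : E.Rglob.PosDef) (hs₀ : ∀ m, (s₀.cov m).PosSemidef) :
    IsRiccatiOrbit E.covTransition E.Phi (E.infoGain C)
      fun q => E.globalCov s₀ y u (q + 1) := by
  refine ⟨fun q => ?_, fun q => globalCov_succ hA1 hA2 hQ hR hs₀ (q + 1)⟩
  simp only [globalCov_succ hA1 hA2 hQ hR hs₀]
  exact posDef_riccatiStep (posDef_Phi hQ) (posSemidef_infoGain hR)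
    (posSemidef_globalCov hA1 hA2 hQ hR hs₀ q)

/-- One step of the error dynamics, in the norms of the current covariances. -/
lemma quad_errorMatrix_le (hA1 : D.A1) (hA2 : E.A2 C) (hQ : E.Qglob.PosDef)
    (hR : E.Rglob.PosDef) (hs₀ : ∀ m, (s₀.cov m).PosSemidef) {q : ℕ}
    (hq : (E.globalCov s₀ y u q).PosDef) (x : D.GlobalIdx → ℝ) :
    (E.γ ^ E.L) ^ 2 * quad (E.globalCov s₀ y u (q + 1))⁻¹ (E.errorMatrix C s₀ y u q *ᵥ x) ≤
      quad (E.globalCov s₀ y u q)⁻¹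
        ((1 + (D.AD E.δ ^ E.L)⁻¹ * D.AFL E.δ E.L) *ᵥ x) := by
  set g := E.γ ^ E.L with hg
  have hunit := (Matrix.isUnit_iff_isUnit_det _).1 ((D.isUnit_AD hA1 E.δ_pos).pow E.L)
  set z := (1 + (D.AD E.δ ^ E.L)⁻¹ * D.AFL E.δ E.L) *ᵥ x with hz
  -- Factoring $\tilde A_D^L$ out on the left and absorbing $\gamma^L$ exhibits the covariance
  -- transition, to which the two nonexpansion estimates apply.
  have h1 : g • ((D.AD E.δ ^ E.L + D.AFL E.δ E.L) *ᵥ x) = E.covTransition *ᵥ z := by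
    rw [covTransition, Matrix.smul_mulVec, hz, Matrix.mulVec_mulVec, Matrix.mul_add,
      ← Matrix.mul_assoc, Matrix.mul_nonsing_inv _ hunit, Matrix.mul_one, Matrix.one_mul]
  have h2 := quad_inv_correction_le (C := Matrix.blockDiagonal' C)
    (posDef_globalPriorCov_succ (y := y) (u := u) hA1 hA2 hQ hR hs₀ q) hR
    (g • ((D.AD E.δ ^ E.L + D.AFL E.δ E.L) *ᵥ x))
  rw [← globalCov_eq hA1 hA2 hQ hR hs₀, ← globalGain_eq hA1 hA2 hQ hR hs₀, Matrix.mulVec_smul,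
    quad_smul_vec, Matrix.mulVec_mulVec, h1, globalPriorCov_succ hA1] at h2
  exact h2.trans (quad_inv_predicted_le (posDef_Phi hQ) hq z)

lemma exponentiallyStable_errorMatrix (hA1 : D.A1) (hA2 : E.A2 C) (hQ : E.Qglob.PosDef)
    (hR : E.Rglob.PosDef) (hs₀ : ∀ m, (s₀.cov m).PosSemidef)
    {P : Matrix D.GlobalIdx D.GlobalIdx ℝ} (hP : P.PosDef)
    (hlim : ∀ s : ℝ, 1 < s → ∀ᶠ q in atTop,
      (∀ x, quad (E.globalCov s₀ y u (q + 1)) x ≤ s * quad P x) ∧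
        ∀ x, quad P x ≤ s * quad (E.globalCov s₀ y u (q + 1)) x)
    (h : inducedNorm P⁻¹ (1 + (D.AD E.δ ^ E.L)⁻¹ * D.AFL E.δ E.L) < E.γ ^ E.L) :
    ExponentiallyStable (E.errorMatrix C s₀ y u) := by
  have hpd := (isRiccatiOrbit_globalCov (y := y) (u := u) hA1 hA2 hQ hR hs₀).1
  obtain ⟨c, hc0, hc, hcle⟩ := exists_quad_lt_of_inducedNorm_lt hP.inv h
  set g := E.γ ^ E.L with hg
  have hgpos : 0 < g := γ_pow_pos
  -- Choose $c<b<b'<\gamma^L$. The first gap makes the divisor $b$ positive even if $c=0$; the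
  -- factor $b'/b$ is paid twice, to exchange the covariances before and after the step for $P$.
  obtain ⟨b, hcb, hbg⟩ := exists_between hc
  have hb : 0 < b := hc0.trans_lt hcb
  obtain ⟨b', hbb', hb'g⟩ := exists_between hbg
  have hs : 1 < b' / b := by rwa [one_lt_div hb]
  obtain ⟨q₀, hq₀⟩ := eventually_atTop.1 (hlim _ hs)
  refine exponentiallyStable_of_eventually_contracting hP.inv (β := b' / g)
    (div_pos (hb.trans hbb') hgpos) (by rwa [div_lt_one hgpos])
    (eventually_atTop.2 ⟨q₀ + 1, fun q hq x => ?_⟩)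
  obtain ⟨j, rfl⟩ : ∃ j, q = j + 1 := ⟨q - 1, by omega⟩
  have hs0 : 0 < b' / b := zero_lt_one.trans hs
  have h1 := quad_inv_le (hpd (j + 1)) hP hs0 (hq₀ (j + 1) (by omega)).1
    (E.errorMatrix C s₀ y u (j + 1) *ᵥ x)
  have h2 := quad_errorMatrix_le hA1 hA2 hQ hR hs₀ (hpd j) x
  have h3 := quad_inv_le hP (hpd j) hs0 (hq₀ j (by omega)).2
    ((1 + (D.AD E.δ ^ E.L)⁻¹ * D.AFL E.δ E.L) *ᵥ x)
  have h4 := hcle x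
  have hx := hP.inv.posSemidef.quad_nonneg x
  rw [← hg] at h2
  have hcb2 : c ^ 2 * quad P⁻¹ x ≤ b ^ 2 * quad P⁻¹ x :=
    mul_le_mul_of_nonneg_right (pow_le_pow_left₀ hc0 hcb.le 2) hx
  have hstep : g ^ 2 * quad P⁻¹ (E.errorMatrix C s₀ y u (j + 1) *ᵥ x) ≤ b' ^ 2 * quad P⁻¹ x :=
    calc g ^ 2 * quad P⁻¹ (E.errorMatrix C s₀ y u (j + 1) *ᵥ x)
        ≤ g ^ 2 * (b' / b * quad (E.globalCov s₀ y u (j + 1 + 1))⁻¹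
            (E.errorMatrix C s₀ y u (j + 1) *ᵥ x)) := mul_le_mul_of_nonneg_left h1 (by positivity)
      _ = b' / b * (g ^ 2 * quad (E.globalCov s₀ y u (j + 1 + 1))⁻¹
            (E.errorMatrix C s₀ y u (j + 1) *ᵥ x)) := by ring
      _ ≤ b' / b * (b' / b * (b ^ 2 * quad P⁻¹ x)) :=
        mul_le_mul_of_nonneg_left (h2.trans (h3.trans (mul_le_mul_of_nonneg_left
          (h4.trans hcb2) hs0.le))) hs0.le
      _ = b' ^ 2 * quad P⁻¹ x := by field_simp
  rw [div_pow, div_mul_eq_mul_div, le_div_iff₀ (by positivity)]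
  linarith

/-- Superposition gives the prior error $e$, in which the common inputs cancel; the innovation is
$\tilde Ce$ plus the measurement noise, and the correction subtracts the gain times it. -/
lemma estError_succ (hA1 : D.A1) (hA2 : E.A2 C) {x : ℕ → D.NodeStates}
    {w : ℕ → ℕ → D.NodeStates} {v : ℕ → ∀ m, Fin (r m) → ℝ} (hx : E.IsPlant x u w y v) (q : ℕ) :
    E.estError x s₀ y u (q + 1) =
      E.errorMatrix C s₀ y u q *ᵥ E.estError x s₀ y u q + E.errorInput C s₀ y u w v q := by
  have hpred := (D.col_schwarz_sub hA1 E.δ_pos (x q) (E.posterior s₀ y u q).est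
    (fun l m => D.Bloc E.δ m *ᵥ u q l m) (w q) E.L).2
  rw [← hx.1 q] at hpred
  set e := D.col (x (q + 1)) - D.col (E.prior s₀ y u (q + 1)).est with he
  have he' : e = (D.AD E.δ ^ E.L + D.AFL E.δ E.L) *ᵥ E.estError x s₀ y u q
      + D.col (D.schwarz E.δ (fun _ _ => 0) (w q) E.L).2 := by
    rw [FEModel.AFL, add_sub_cancel]
    exact hpred
  have hpost : E.estError x s₀ y u (q + 1) =
      (1 - E.globalGain s₀ y u (q + 1) * Matrix.blockDiagonal' C) *ᵥ e
        - E.globalGain s₀ y u (q + 1) *ᵥ fun a => v (q + 1) a.1 a.2 := by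
    have hinnov : D.col (fun m => E.gain (E.prior s₀ y u (q + 1)) m *ᵥ
        (y (q + 1) m - E.h m ((E.prior s₀ y u (q + 1)).est m))) =
        E.globalGain s₀ y u (q + 1) *ᵥ
          (Matrix.blockDiagonal' C *ᵥ e + fun a : Σ m, Fin (r m) => v (q + 1) a.1 a.2) := by
      funext ⟨m, i⟩
      rw [globalGain, blockDiagonal'_mulVec (a := fun m => D.internal m)]
      have hin : (y (q + 1) m - E.h m ((E.prior s₀ y u (q + 1)).est m)) =
          fun k => (Matrix.blockDiagonal' C *ᵥ e + fun a : Σ m, Fin (r m) => v (q + 1) a.1 a.2) ⟨m, k⟩ := by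
        funext k
        rw [hx.2, hA2.1, hA2.1, Pi.add_apply,
          blockDiagonal'_mulVec (b := fun m => D.internal m)]
        have : (fun i => e ⟨m, i⟩) = x (q + 1) m - (E.prior s₀ y u (q + 1)).est m := rfl
        simp only [this, Matrix.mulVec_sub, Pi.add_apply, Pi.sub_apply]
        ring
      rw [← hin]
      rfl
    have hsplit : E.estError x s₀ y u (q + 1) = e -
        D.col (fun m => E.gain (E.prior s₀ y u (q + 1)) m *ᵥ
          (y (q + 1) m - E.h m ((E.prior s₀ y u (q + 1)).est m))) := by
      rw [he, sub_sub]
      rfl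
    rw [hsplit, hinnov, Matrix.mulVec_add, Matrix.sub_mulVec, Matrix.one_mulVec,
      Matrix.mulVec_mulVec]
    abel
  rw [hpost, he', errorMatrix, errorInput, Matrix.mulVec_add, Matrix.mulVec_mulVec]
  abel

end Run

end FEFilter

end

theorem theorem2 {d n N : ℕ} {V W : Type*} [NormedAddCommGroup V] [InnerProductSpace ℝ V]
    [CompleteSpace V] [AddCommGroup W] [Module ℝ W]
    (D : FEModel d n N V W) (r : Fin N → ℕ) (E : FEFilter D r)
    (C : ∀ m, Matrix (Fin (r m)) (D.internal m) ℝ)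
    (hA1 : D.A1) (hA2 : E.A2 C) (hQ : E.Qglob.PosDef) (hR : E.Rglob.PosDef) :
    ∃ P : Matrix D.GlobalIdx D.GlobalIdx ℝ,
      -- `P` is the unique positive solution of the Riccati equation
      (P.PosDef ∧ E.Riccati C P ∧ ∀ P', P'.PosDef → E.Riccati C P' → P' = P) ∧
      -- for every run of the filter
      ∀ (s₀ : FEFilter.State D) (y : ℕ → ∀ m, Fin (r m) → ℝ) (u : ℕ → ℕ → D.NodeStates),
        (∀ m, (s₀.cov m).PosSemidef) →
        -- the global covariance converges to `P`
        Tendsto (E.globalCov s₀ y u) atTop (𝓝 P) ∧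
        -- the estimation error obeys the linear error dynamics
        (∀ (x : ℕ → D.NodeStates) (w : ℕ → ℕ → D.NodeStates) (v : ℕ → ∀ m, Fin (r m) → ℝ),
          E.IsPlant x u w y v → ∀ q,
            E.estError x s₀ y u (q + 1) =
              E.errorMatrix C s₀ y u q *ᵥ E.estError x s₀ y u q
                + E.errorInput C s₀ y u w v q) ∧
        -- which is exponentially stable under the gain condition
        (inducedNorm P⁻¹ (1 + (D.AD E.δ ^ E.L)⁻¹ * D.AFL E.δ E.L) < E.γ ^ E.L →
          ExponentiallyStable (E.errorMatrix C s₀ y u)) := by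
  have hΦ := FEFilter.posDef_Phi hQ
  have hH := FEFilter.posSemidef_infoGain (C := C) hR
  obtain ⟨P, hP, hfix⟩ := exists_riccatiStep_eq_self (FEFilter.isUnit_covTransition hA1) hΦ hH
    (FEFilter.eq_zero_of_quad_infoGain_eq_zero hA1 hA2 hR)
  refine ⟨P, ⟨hP, (FEFilter.riccati_iff hQ hR hP).2 hfix, fun P' hP' hR' =>
    riccatiStep_fixedPoint_unique hΦ hH hP hP' hfix ((FEFilter.riccati_iff hQ hR hP').1 hR')⟩,
    fun s₀ y u hs₀ => ?_⟩
  have horbit := FEFilter.isRiccatiOrbit_globalCov (y := y) (u := u) hA1 hA2 hQ hR hs₀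
  have hlim := fun s (hs : (1 : ℝ) < s) => horbit.eventually_le hΦ hH hP hfix hs
  exact ⟨(tendsto_add_atTop_iff_nat 1).1 (tendsto_of_eventually_le
      (fun k => (horbit.1 k).posSemidef.transpose_eq) hP hlim),
    fun x w v hx q => FEFilter.estError_succ hA1 hA2 hx q,
    fun h => FEFilter.exponentiallyStable_errorMatrix hA1 hA2 hQ hR hs₀ hP hlim h⟩
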